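/- Let $n\ge 1$, let $\Omega\subset\mathbb R^n$ be a bounded open set, let $p\ge 2$ and $m>1$, let $\vec a\in C^\infty(\bar\Omega;\mathbb R^n)$ be a smooth vector field, let $f\in L^2(\Omega)$ and let $a_0\in L^\infty(\Omega)$ satisfy $\tfrac12(\operatorname{div}\vec a+a_0)\ge 0$ a.e. on $\Omega$. Let $W^{1,p}_0(\Omega)\subset L^2(\Omega)$ be the closure of $C_c^\infty(\Omega)$ in $W^{1,p}(\Omega)$, and let $$Au=\vec a\cdot\nabla u+\tfrac12(\operatorname{div}\vec a)\,u \quad\text{(in the sense of distributions)},\qquad D(A)=\{u\in L^2(\Omega):\ \vec a\cdot\nabla u+\tfrac12(\operatorname{div}\vec a)u\in L^2(\Omega)\}.$$ Define $\varphi:L^2(\Omega)\to(-\infty,+\infty]$ by $$\varphi(u)=\frac1p\int_\Omega|\nabla u|^p\,dx+\frac14\int_\Omega(\operatorname{div}\vec a+a_0)|u|^2\,dx+\frac1m\int_\Omega|u|^m\,dx+\int_\Omega uf\,dx$$ if $u\in W^{1,p}_0(\Omega)$ (the value is $+\infty$ if $\int_\Omega|u|^m\,dx=+\infty$), and $\varphi(u)=+\infty$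 if $u\notin W^{1,p}_0(\Omega)$. Let $\varphi^*(q)=\sup_{v\in L^2(\Omega)}\big(\int_\Omega vq\,dx-\varphi(v)\big)$ for $q\in L^2(\Omega)$. Then $W^{1,p}_0(\Omega)\subset D(A)$, and the functional $I(u)=\varphi(u)+\varphi^*(Au)$ on $W^{1,p}_0(\Omega)$ has the following properties. 1. There exists $\bar u\in W^{1,p}_0(\Omega)$ such that $I(\bar u)=\inf\{I(u):\ u\in W^{1,p}_0(\Omega)\}=0$. 2. Every such minimizer $\bar u$ is a weak solution of $$-\Delta_p\bar u+\tfrac12a_0\bar u+\bar u|\bar u|^{m-2}+f=\vec a\cdot\nabla\bar u\ \text{ on }\Omega,\qquad \bar u=0\ \text{ on }\partial\Omega,$$ that is, $\bar u\in W^{1,p}_0(\Omega)$, the functions $|\nabla\bar u|^{p-2}\nabla\bar u$ and $\bar u|\bar u|^{m-2}$ are locally integrable on $\Omega$, and for all $\psi\in C_c^\infty(\Omega)$ $$\int_\Omega|\nabla\bar u|^{p-2}\nabla\bar u\cdot\nabla\psi\,dx+\int_\Omega\Big(\tfrac12a_0\bar u+\bar u|\bar u|^{m-2}+f\Big)\psi\,dx=\int_\Omega(\vec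 a\cdot\nabla\bar u)\,\psi\,dx .$$ -/

import Mathlib

open MeasureTheory Filter Topology
open scoped ContDiff ENNReal

noncomputable section

namespace ASD

/-- Euclidean space `ℝⁿ`. -/
abbrev Rn (n : ℕ) : Type := EuclideanSpace ℝ (Fin n)

/-- The Hilbert space `L²(Ω)` of real functions, with respect to Lebesgue measure on `Ω`. -/
abbrev L2 {n : ℕ} (Ω : Set (Rn n)) : Type := Lp ℝ 2 (volume.restrict Ω)

/-- The test functions `C_c^∞(Ω)`, extended by zero to the whole space. -/
def IsTest {n : ℕ} (Ω : Set (Rn n)) (ψ : Rn n → ℝ) : Prop :=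
  ContDiff ℝ ∞ ψ ∧ HasCompactSupport ψ ∧ tsupport ψ ⊆ Ω

/-- The divergence `∑ i, ∂ᵢ aᵢ` of a vector field. -/
def divergence {n : ℕ} (a : Rn n → Rn n) (x : Rn n) : ℝ :=
  ∑ i : Fin n, (fderiv ℝ a x (EuclideanSpace.single i 1)) i

/-- `G` is the weak (distributional) gradient of `u` on `Ω`, both being locally integrable:
`∫ u ∇ψ = - ∫ ψ G` for all test functions `ψ`. -/
def HasWeakGradient {n : ℕ} (Ω : Set (Rn n)) (u : Rn n → ℝ) (G : Rn n → Rn n) : Prop :=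
  LocallyIntegrableOn u Ω ∧ LocallyIntegrableOn G Ω ∧
    ∀ ψ : Rn n → ℝ, IsTest Ω ψ →
      ∫ x in Ω, u x • gradient ψ x = -∫ x in Ω, ψ x • G x

open Classical in
/-- The weak gradient `∇u` on `Ω` (unique up to null sets for open `Ω`; zero if there is none). -/
def weakGradient {n : ℕ} (Ω : Set (Rn n)) (u : Rn n → ℝ) : Rn n → Rn n :=
  if h : ∃ G, HasWeakGradient Ω u G then h.choose else 0

/-- `u ∈ W^{1,p}(Ω)`. -/
def MemW1p {n : ℕ} (Ω : Set (Rn n)) (p : ℝ) (u : Rn n → ℝ) : Prop :=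
  MemLp u (ENNReal.ofReal p) (volume.restrict Ω) ∧
    ∃ G : Rn n → Rn n, HasWeakGradient Ω u G ∧ MemLp G (ENNReal.ofReal p) (volume.restrict Ω)

/-- `u ∈ W₀^{1,p}(Ω)`, the closure of `C_c^∞(Ω)` in `W^{1,p}(Ω)`. -/
def MemW1p0 {n : ℕ} (Ω : Set (Rn n)) (p : ℝ) (u : Rn n → ℝ) : Prop :=
  MemW1p Ω p u ∧
    ∃ ψ : ℕ → Rn n → ℝ, (∀ k, IsTest Ω (ψ k)) ∧
      Tendsto (fun k => eLpNorm (ψ k - u) (ENNReal.ofReal p) (volume.restrict Ω)) atTop (𝓝 0) ∧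
      Tendsto (fun k => eLpNorm (gradient (ψ k) - weakGradient Ω u) (ENNReal.ofReal p)
        (volume.restrict Ω)) atTop (𝓝 0)

/-- `W₀^{1,p}(Ω)` as a subset of `L²(Ω)`; for bounded `Ω` and `p ≥ 2` this is the whole space. -/
def W1p0 {n : ℕ} (Ω : Set (Rn n)) (p : ℝ) : Set (L2 Ω) :=
  {u | MemW1p0 Ω p u}

open Classical in
/-- The energy
`φ(u) = (1/p) ∫ |∇u|^p + (1/4) ∫ (div a + a₀) |u|² + (1/m) ∫ |u|^m + ∫ u f` on `W₀^{1,p}(Ω)`,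
and `φ = +∞` elsewhere on `L²(Ω)`. The `m`-power integral may be `+∞` and is a lower integral;
the other three are finite on `W₀^{1,p}(Ω)`. -/
def energy {n : ℕ} (Ω : Set (Rn n)) (p m : ℝ) (a : Rn n → Rn n) (a₀ f : Rn n → ℝ)
    (u : L2 Ω) : EReal :=
  if u ∈ W1p0 Ω p then
    (((1 / p) * (∫ x in Ω, ‖weakGradient Ω u x‖ ^ p)
        + (1 / 4) * (∫ x in Ω, (divergence a x + a₀ x) * |u x| ^ 2)
        + ∫ x in Ω, u x * f x : ℝ) : EReal)
      + ((ENNReal.ofReal (1 / m) * ∫⁻ x in Ω, ‖u x‖ₑ ^ m : ℝ≥0∞) : EReal)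
  else ⊤

/-- The Fenchel–Legendre conjugate `φ*(q) = sup_v (⟨v, q⟩ - φ(v))` on a Hilbert space. -/
def conjugate {H : Type*} [NormedAddCommGroup H] [InnerProductSpace ℝ H]
    (φ : H → EReal) (q : H) : EReal :=
  ⨆ v : H, ((inner ℝ v q : ℝ) : EReal) - φ v

/-- `a · ∇u + (1/2) (div a) u = g` on `Ω` in the sense of distributions; the formal adjoint of
this operator is its negative. -/
def IsTransport {n : ℕ} (Ω : Set (Rn n)) (a : Rn n → Rn n) (u g : L2 Ω) : Prop :=
  ∀ ψ : Rn n → ℝ, IsTest Ω ψ →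
    ∫ x in Ω, g x * ψ x =
      -∫ x in Ω, u x * (inner ℝ (a x) (gradient ψ x) + (1 / 2) * divergence a x * ψ x)

/-- `D(A) = {u ∈ L²(Ω) | a · ∇u + (1/2) (div a) u ∈ L²(Ω)}`. -/
def transportDomain {n : ℕ} (Ω : Set (Rn n)) (a : Rn n → Rn n) : Set (L2 Ω) :=
  {u | ∃ g : L2 Ω, IsTransport Ω a u g}

open Classical in
/-- The operator `A u = a · ∇u + (1/2) (div a) u` on `D(A)` (extended by zero outside `D(A)`).
For open `Ω` the element `g` is unique. -/
def transport {n : ℕ} (Ω : Set (Rn n)) (a : Rn n → Rn n) (u : L2 Ω) : L2 Ω :=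
  if h : ∃ g : L2 Ω, IsTransport Ω a u g then h.choose else 0

/-- The functional `I(u) = φ(u) + φ*(A u)`. -/
def functional {n : ℕ} (Ω : Set (Rn n)) (p m : ℝ) (a : Rn n → Rn n) (a₀ f : Rn n → ℝ)
    (u : L2 Ω) : EReal :=
  energy Ω p m a a₀ f u + conjugate (energy Ω p m a a₀ f) (transport Ω a u)

/-- `u` is a weak solution of `-Δ_p u + (1/2) a₀ u + u |u|^(m-2) + f = a · ∇u` on `Ω`, `u = 0` on
`∂Ω`: it lies in `W₀^{1,p}(Ω)`, the nonlinear terms are locally integrable, and the equation holds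
in the sense of distributions, where `Δ_p u = div (|∇u|^(p-2) ∇u)`. -/
def IsWeakSolution {n : ℕ} (Ω : Set (Rn n)) (p m : ℝ) (a : Rn n → Rn n) (a₀ f : Rn n → ℝ)
    (u : L2 Ω) : Prop :=
  u ∈ W1p0 Ω p ∧
  LocallyIntegrableOn (fun x => ‖weakGradient Ω u x‖ ^ (p - 2) • weakGradient Ω u x) Ω ∧
  LocallyIntegrableOn (fun x => u x * |u x| ^ (m - 2)) Ω ∧
  ∀ ψ : Rn n → ℝ, IsTest Ω ψ →
    (∫ x in Ω, ‖weakGradient Ω u x‖ ^ (p - 2) * inner ℝ (weakGradient Ω u x) (gradient ψ x))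
        + (∫ x in Ω, (1 / 2) * a₀ x * u x * ψ x)
        + (∫ x in Ω, u x * |u x| ^ (m - 2) * ψ x)
        + (∫ x in Ω, f x * ψ x)
      = ∫ x in Ω, inner ℝ (a x) (weakGradient Ω u x) * ψ x

end ASD

end

/-! Write `Φ` for `φ` on its effective domain and `⟨A u, v⟩` for the `L²` pairing. The operator `A`
is skew-symmetric on `W₀^{1,p}`: half of the divergence term makes its formal adjoint equal to `-A`.
Hence `⟨A u, u⟩ = 0`, and the Fenchel–Young inequality `φ(u) + φ*(A u) ≥ ⟨u, A u⟩` gives `I ≥ 0`.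
Moreover `I(u) = 0` means exactly `A u ∈ ∂φ(u)`, that is, `Φ(u) - Φ(v) + ⟨A u, v⟩ ≤ 0` for all `v`
in the domain (`energy_add_conjugate_nonpos_iff`).

Such a `u` exists by a Ky Fan argument (`exists_forall_sub_add_skew_nonpos`). For finitely many `v`
the left side is a skew payoff matrix. An optimal mixed strategy gives a convex combination that
satisfies all these inequalities, because the left side is convex in `u`. The passage to all `v`
uses no weak topology. Each inequality cuts out a closed convex set, the choice `v = 0` bounds the
gradient, and the uniform convexity of `‖∇u‖^p` (Clarkson) makes near-minimizers over growing finite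
intersections a Cauchy sequence. Poincaré's inequality transfers this from gradients to pairs `(u,
∇u)`.

A zero `u` of `I` minimizes `v ↦ Φ(v) - ⟨A u, v⟩`. The derivative along a test function vanishes
(`euler_lagrange_of_forall_le`). The term `(1/2) (div a) u` occurs both in `∇φ` and in `A u`, and
its cancellation leaves the stated equation. The `m`-power may be infinite on `W₀^{1,p}`, but adding
a bounded test function keeps it finite, so two-sided variations are allowed. -/

namespace ASD

/-! ### Minimax: finite skew games, uniform convexity, Ky Fan's inequality -/

/-- A symmetric finite zero-sum game has an optimal mixed strategy of value zero. -/
theorem exists_stdSimplex_sum_nonpos {ι : Type*} [Fintype ι] [Nonempty ι] (M : ι → ι → ℝ)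
    (hM : ∀ i j, M i j = -M j i) :
    ∃ w ∈ stdSimplex ℝ ι, ∀ j, ∑ i, w i * M i j ≤ 0 := by
  classical
  by_contra! hcon
  set T : (ι → ℝ) →ₗ[ℝ] (ι → ℝ) := (Matrix.of M).vecMulLinear with hT
  have hTa : ∀ w j, T w j = ∑ i, w i * M i j := fun w j => rfl
  have hTc : Continuous T := T.continuous_of_finiteDimensional
  -- If every strategy had a positive payoff somewhere, the compact convex set of payoff vectors
  -- would miss the nonpositive orthant and could be strictly separated from it.
  have hdisj : Disjoint (T '' stdSimplex ℝ ι) (Set.Iic 0) := by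
    rw [Set.disjoint_left]
    rintro _ ⟨w, hw, rfl⟩ hle
    obtain ⟨j, hj⟩ := hcon w hw
    exact absurd (hle j) (by rw [hTa]; simpa using hj)
  obtain ⟨f, u, v, hfu, huv, hfv⟩ := geometric_hahn_banach_compact_closed
    ((convex_stdSimplex ℝ ι).linear_image T) ((isCompact_stdSimplex ℝ ι).image hTc)
    (convex_Iic (0 : ι → ℝ)) isClosed_Iic hdisj
  have hv : v < 0 := by simpa using hfv 0 (by simp)
  set c : ι → ℝ := fun j => -f (Pi.single j 1) with hc
  have hfc : ∀ y : ι → ℝ, f y = -∑ j, y j * c j := by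
    intro y
    conv_lhs => rw [pi_eq_sum_univ' y]
    simp only [map_sum, map_smul, smul_eq_mul, hc, mul_neg, Finset.sum_neg_distrib, neg_neg]
  have hcnn : ∀ j, 0 ≤ c j := by
    intro j
    by_contra! hneg
    -- At this multiple of the basis vector `f` takes exactly the value `v`, although the point lies
    -- in the orthant, where `f > v`.
    have h1 := hfv (-(v / c j) • Pi.single j 1) (by
      rw [Set.mem_Iic]
      intro i
      have : 0 < v / c j := div_pos_of_neg_of_neg hv hneg
      by_cases hij : i = j
      · subst hij; simp [this.le]
      · simp [hij])
    rw [map_smul, smul_eq_mul] at h1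
    have h2 : f (Pi.single j 1) = -c j := by simp [hc]
    rw [h2] at h1
    have h3 : -(v / c j) * -c j = v := by field_simp [hneg.ne]
    exact lt_irrefl _ (h3 ▸ h1)
  have hS : 0 < ∑ j, c j := by
    refine (Finset.sum_nonneg fun j _ => hcnn j).lt_of_ne' fun h0 => ?_
    have hz : ∀ j, c j = 0 := fun j =>
      (Finset.sum_eq_zero_iff_of_nonneg fun j _ => hcnn j).1 h0 j (Finset.mem_univ j)
    obtain ⟨i⟩ := ‹Nonempty ι›
    have := hfu _ ⟨_, single_mem_stdSimplex ℝ i, rfl⟩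
    rw [hfc] at this
    simp only [hz, mul_zero, Finset.sum_const_zero, neg_zero] at this
    linarith
  have hw : (∑ j, c j)⁻¹ • c ∈ stdSimplex ℝ ι := by
    refine ⟨fun j => mul_nonneg (inv_nonneg.2 hS.le) (hcnn j), ?_⟩
    simp only [Pi.smul_apply, smul_eq_mul, ← Finset.mul_sum]
    exact inv_mul_cancel₀ hS.ne'
  have h1 := hfu _ ⟨_, hw, rfl⟩
  rw [hfc, map_smul] at h1
  -- The normalized `c` is itself a strategy. By skewness `f` vanishes at its payoff vector, whereas
  -- separation makes `f` negative there.
  have hskew : ∑ j, T c j * c j = 0 := by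
    have h2 : ∑ j, T c j * c j = ∑ j, ∑ i, c i * M i j * c j := by
      simp only [hTa, Finset.sum_mul]
    have h3 : ∑ j, ∑ i, c i * M i j * c j = -∑ j, ∑ i, c i * M i j * c j := by
      conv_lhs => rw [Finset.sum_comm]
      rw [← Finset.sum_neg_distrib]
      refine Finset.sum_congr rfl fun i _ => ?_
      rw [← Finset.sum_neg_distrib]
      refine Finset.sum_congr rfl fun j _ => ?_
      rw [hM i j]; ring
    linarith
  simp only [Pi.smul_apply, smul_eq_mul, mul_assoc, ← Finset.mul_sum, hskew] at h1
  simp at h1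
  linarith

/-- Closed convex sets on which a uniformly convex function has bounded infima over finite
intersections have a common point. -/
theorem exists_mem_forall_of_uniformlyConvex {E ι : Type*} [NormedAddCommGroup E]
    [NormedSpace ℝ E] [CompleteSpace E] [Nonempty ι] {D : Set E} (hD : Convex ℝ D)
    {N : E → ℝ} {κ p : ℝ} (hκ : 0 < κ) (hp : 0 < p) (hN : ∀ x, 0 ≤ N x)
    (hNu : ∀ x ∈ D, ∀ y ∈ D, N (midpoint ℝ x y) + κ * ‖x - y‖ ^ p ≤ (N x + N y) / 2)
    {C : ι → Set E} (hclosed : ∀ i, IsClosed (C i)) (hconv : ∀ i, Convex ℝ (C i))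
    {R : ℝ} (hR : ∀ s : Finset ι, ∃ x ∈ D, (∀ i ∈ s, x ∈ C i) ∧ N x ≤ R) :
    ∃ x, ∀ i, x ∈ C i := by
  classical
  set K : Finset ι → Set E := fun s => {x | x ∈ D ∧ ∀ i ∈ s, x ∈ C i} with hK
  have hKanti : ∀ s t : Finset ι, s ⊆ t → K t ⊆ K s := fun s t hst x hx =>
    ⟨hx.1, fun i hi => hx.2 i (hst hi)⟩
  set d : Finset ι → ℝ := fun s => sInf (N '' K s) with hd
  have hbdd : ∀ s, BddBelow (N '' K s) := fun s => ⟨0, by rintro _ ⟨x, -, rfl⟩; exact hN x⟩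
  have hdle : ∀ s, ∀ x ∈ K s, d s ≤ N x := fun s x hx => csInf_le (hbdd s) ⟨x, hx, rfl⟩
  have hne : ∀ s, (N '' K s).Nonempty := fun s => by
    obtain ⟨x, hx, hxs, -⟩ := hR s
    exact ⟨_, x, ⟨hx, hxs⟩, rfl⟩
  have hdR : BddAbove (Set.range d) := by
    refine ⟨R, ?_⟩
    rintro _ ⟨s, rfl⟩
    obtain ⟨x, hx, hxs, hxR⟩ := hR s
    exact (hdle s x ⟨hx, hxs⟩).trans hxR
  set d₀ : ℝ := ⨆ s, d s with hd₀
  have hmin : ∀ (s : Finset ι) (ε : ℝ), 0 < ε → ∃ x ∈ K s, N x < d₀ + ε := by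
    intro s ε hε
    obtain ⟨_, ⟨x, hx, rfl⟩, hlt⟩ := exists_lt_of_csInf_lt (hne s)
      (show sInf (N '' K s) < d₀ + ε from (le_ciSup hdR s).trans_lt (by linarith))
    exact ⟨x, hx, hlt⟩
  have hmid : ∀ s, ∀ x ∈ K s, ∀ y ∈ K s, midpoint ℝ x y ∈ K s := fun s x hx y hy =>
    ⟨hD.midpoint_mem hx.1 hy.1, fun i hi => (hconv i).midpoint_mem (hx.2 i hi) (hy.2 i hi)⟩
  -- The midpoint stays in `K s`, so `d₀ - ε < d s ≤ N (midpoint) < d₀ + ε - κ ‖x - y‖ ^ p`.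
  have hclose : ∀ (s : Finset ι) (ε : ℝ), d₀ - ε < d s → ∀ x ∈ K s, ∀ y ∈ K s,
      N x < d₀ + ε → N y < d₀ + ε → dist x y ≤ (2 * ε / κ) ^ p⁻¹ := by
    intro s ε hs x hx y hy hNx hNy
    have h1 := hNu x hx.1 y hy.1
    have h2 := hdle s _ (hmid s x hx y hy)
    have h3 : ‖x - y‖ ^ p ≤ 2 * ε / κ := by
      rw [le_div_iff₀ hκ]; nlinarith
    rw [dist_eq_norm]
    calc ‖x - y‖ = (‖x - y‖ ^ p) ^ p⁻¹ := (Real.rpow_rpow_inv (norm_nonneg _) hp.ne').symm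
      _ ≤ _ := Real.rpow_le_rpow (by positivity) h3 (by positivity)
  have hε : ∀ k : ℕ, (0 : ℝ) < 1 / ((k : ℝ) + 1) := fun k => by positivity
  have hF : ∀ k : ℕ, ∃ s, d₀ - 1 / ((k : ℝ) + 1) < d s := fun k =>
    exists_lt_of_lt_ciSup (show d₀ - 1 / ((k : ℝ) + 1) < ⨆ s, d s by linarith [hε k])
  choose F hF using hF
  -- Accumulating the `F j` puts `x k` into `K (F j)` for every `j ≤ k`, as the Cauchy estimate
  -- requires.
  set G : ℕ → Finset ι := fun k => (Finset.range (k + 1)).biUnion F with hG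
  have hFG : ∀ j k, j ≤ k → F j ⊆ G k := fun j k hjk =>
    Finset.subset_biUnion_of_mem F (Finset.mem_range.2 (by omega))
  choose x hx hNx using fun k : ℕ => hmin (G k) _ (hε k)
  have hb : Tendsto (fun k : ℕ => (2 * (1 / ((k : ℝ) + 1)) / κ) ^ p⁻¹) atTop (𝓝 0) := by
    have h1 : Tendsto (fun k : ℕ => 2 * (1 / ((k : ℝ) + 1)) / κ) atTop (𝓝 0) := by
      simpa using (tendsto_one_div_add_atTop_nhds_zero_nat.const_mul 2).div_const κ
    have h2 := h1.rpow_const (p := p⁻¹) (Or.inr (by positivity))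
    rwa [Real.zero_rpow (inv_ne_zero hp.ne')] at h2
  have hmono : ∀ j k : ℕ, j ≤ k → 1 / ((k : ℝ) + 1) ≤ 1 / ((j : ℝ) + 1) := fun j k hjk =>
    one_div_le_one_div_of_le (by positivity) (by simpa using hjk)
  have hcau : CauchySeq x := by
    refine cauchySeq_of_le_tendsto_0 _ (fun i j k hki hkj => ?_) hb
    exact hclose (F k) _ (hF k) _ (hKanti _ _ (hFG k i hki) (hx i)) _
      (hKanti _ _ (hFG k j hkj) (hx j)) ((hNx i).trans_le (by linarith [hmono k i hki]))
      ((hNx j).trans_le (by linarith [hmono k j hkj]))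
  obtain ⟨z, hz⟩ := cauchySeq_tendsto_of_complete hcau
  refine ⟨z, fun i => ?_⟩
  -- Near-minimizers that also lie in `C i` are close to `x k`, so they have the same limit `z`, and
  -- `C i` is closed.
  choose y hy hNy using fun k : ℕ => hmin (insert i (G k)) _ (hε k)
  have hyx : Tendsto (fun k => dist (x k) (y k)) atTop (𝓝 0) := by
    refine squeeze_zero (fun _ => dist_nonneg) (fun k => ?_) hb
    exact hclose (F k) _ (hF k) _ (hKanti _ _ (hFG k k le_rfl) (hx k)) _
      (hKanti _ _ ((hFG k k le_rfl).trans (Finset.subset_insert _ _)) (hy k)) (hNx k) (hNy k)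
  exact (hclosed i).mem_of_tendsto (tendsto_of_tendsto_of_dist hz hyx)
    (Eventually.of_forall fun k => (hy k).2 i (Finset.mem_insert_self _ _))

/-- Ky Fan's inequality for `Φ u - Φ v + B u v` with `Φ` convex and `B` skew-symmetric. -/
theorem exists_forall_sub_add_skew_nonpos {E : Type*} [NormedAddCommGroup E]
    [NormedSpace ℝ E] [CompleteSpace E] {D : Set E} {v₀ : E} (hv₀ : v₀ ∈ D)
    {N : E → ℝ} {κ p : ℝ} (hκ : 0 < κ) (hp : 0 < p) (hN : ∀ x, 0 ≤ N x)
    (hNu : ∀ x ∈ D, ∀ y ∈ D, N (midpoint ℝ x y) + κ * ‖x - y‖ ^ p ≤ (N x + N y) / 2)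
    {Φ : E → ℝ} (hΦ : ConvexOn ℝ D Φ) (B : E →ₗ[ℝ] E →ₗ[ℝ] ℝ)
    (hB : ∀ x ∈ D, ∀ y ∈ D, B x y = -B y x)
    (hclosed : ∀ v ∈ D, IsClosed {u | u ∈ D ∧ Φ u - Φ v + B u v ≤ 0})
    {R : ℝ} (hR : ∀ u ∈ D, Φ u - Φ v₀ + B u v₀ ≤ 0 → N u ≤ R) :
    ∃ u ∈ D, ∀ v ∈ D, Φ u - Φ v + B u v ≤ 0 := by
  classical
  have : Nonempty D := ⟨⟨v₀, hv₀⟩⟩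
  have hlin : ∀ v, ConvexOn ℝ D (fun u => Φ u - Φ v + B u v) := fun v => by
    have h1 : ConvexOn ℝ D (fun u => B.flip v u) := (B.flip v).convexOn hΦ.1
    have h2 := (hΦ.add_const (-Φ v)).add h1
    refine h2.congr fun u _ => ?_
    simp [sub_eq_add_neg]
  obtain ⟨u, hu⟩ := exists_mem_forall_of_uniformlyConvex (ι := D) hΦ.1 hκ hp hN hNu
    (C := fun v => {u | u ∈ D ∧ Φ u - Φ v + B u v ≤ 0}) (fun v => hclosed v v.2)
    (fun v => (hlin v).convex_le 0) (R := R) (fun s => by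
      -- Including `v₀` lets the a priori bound `hR` apply to the point found for `s`.
      set t : Finset D := insert ⟨v₀, hv₀⟩ s with ht
      have : Nonempty t := ⟨⟨⟨v₀, hv₀⟩, Finset.mem_insert_self _ _⟩⟩
      obtain ⟨w, hw, hwle⟩ := exists_stdSimplex_sum_nonpos
        (fun i j : t => Φ (i : D) - Φ (j : D) + B (i : D) (j : D)) (fun i j => by
          rw [hB (i : D) (i : D).2 (j : D) (j : D).2]; ring)
      set u : E := ∑ i : t, w i • ((i : D) : E) with hu
      have huD : u ∈ D := hΦ.1.sum_mem (fun i _ => hw.1 i) hw.2 (fun i _ => (i : D).2)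
      -- Jensen's inequality in the first variable: the value at the barycentre `u` is at most the
      -- payoff of the mixed strategy `w`.
      have hle : ∀ j ∈ t, Φ u - Φ (j : D) + B u (j : D) ≤ 0 := fun j hj =>
        ((hlin j).map_sum_le (t := Finset.univ) (w := w) (p := fun i : t => ((i : D) : E))
          (fun i _ => hw.1 i) hw.2 (fun i _ => (i : D).2)).trans (by
            simpa using hwle ⟨j, hj⟩)
      exact ⟨u, huD, fun i hi => ⟨huD, hle i (Finset.mem_insert_of_mem hi)⟩,
        hR u huD (hle ⟨v₀, hv₀⟩ (Finset.mem_insert_self _ _))⟩)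
  exact ⟨u, (hu ⟨v₀, hv₀⟩).1, fun v hv => (hu ⟨v, hv⟩).2⟩

end ASD

/-! ### Lebesgue spaces: multiplication operators, Clarkson's inequality, derivatives of power
integrals -/

namespace ASD

section Lp

variable {α F G H : Type*} [MeasurableSpace α] {μ : Measure α}
  [NormedAddCommGroup F] [NormedAddCommGroup G] [NormedSpace ℝ G]
  [NormedAddCommGroup H] [InnerProductSpace ℝ H]

/-- Pointwise application of a bounded family of operators maps `Lp` to `Lq` continuously, if
`q ≤ p` and the measure is finite. -/
theorem exists_clm_Lp [NormedSpace ℝ F] [IsFiniteMeasure μ] {P Q : ℝ≥0∞} [Fact (1 ≤ P)]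
    [hQ : Fact (1 ≤ Q)] (hP : Q ≤ P)
    {b : α → F →L[ℝ] G} (hb : AEStronglyMeasurable b μ) {C : ℝ} (hC : ∀ᵐ r ∂μ, ‖b r‖ ≤ C) :
    ∃ T : Lp F P μ →L[ℝ] Lp G Q μ, ∀ x, T x =ᵐ[μ] fun r => b r (x r) := by
  obtain ⟨C, hC0, hC⟩ : ∃ C' : ℝ, 0 ≤ C' ∧ ∀ᵐ r ∂μ, ‖b r‖ ≤ C' :=
    ⟨|C|, abs_nonneg C, hC.mono fun r hr => hr.trans (le_abs_self C)⟩
  have hm : ∀ x : Lp F P μ, AEStronglyMeasurable (fun r => b r (x r)) μ := fun x =>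
    (isBoundedBilinearMap_apply (𝕜 := ℝ) (E := F) (F := G)).continuous.comp_aestronglyMeasurable
      (hb.prodMk (Lp.aestronglyMeasurable x))
  have hbd : ∀ x : Lp F P μ, ∀ᵐ r ∂μ, ‖b r (x r)‖ ≤ C * ‖x r‖ := fun x => by
    filter_upwards [hC] with r hr
    exact (b r).le_of_opNorm_le hr _
  have hmem : ∀ x : Lp F P μ, MemLp (fun r => b r (x r)) Q μ := fun x =>
    ((Lp.memLp x).mono_exponent hP).of_le_mul (hm x) (hbd x)
  set K : ℝ≥0∞ := μ Set.univ ^ (1 / Q.toReal - 1 / P.toReal) with hK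
  have hKtop : K ≠ ⊤ := by
    refine ENNReal.rpow_ne_top_of_nonneg ?_ (measure_ne_top _ _)
    rw [sub_nonneg]
    rcases eq_or_ne P ⊤ with rfl | hPt
    · simp
    · exact one_div_le_one_div_of_le
        (ENNReal.toReal_pos (one_pos.trans_le hQ.out).ne' (ne_top_of_le_ne_top hPt hP))
        (ENNReal.toReal_mono hPt hP)
  refine ⟨LinearMap.mkContinuous
    { toFun := fun x => (hmem x).toLp _
      map_add' := fun x y => ?_
      map_smul' := fun c x => ?_ } (C * K.toReal) fun x => ?_, fun x => (hmem x).coeFn_toLp⟩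
  · rw [← MemLp.toLp_add]
    refine MemLp.toLp_congr _ _ ?_
    filter_upwards [Lp.coeFn_add x y] with r hr
    rw [hr, Pi.add_apply, map_add]; rfl
  · rw [RingHom.id_apply, ← MemLp.toLp_const_smul]
    refine MemLp.toLp_congr _ _ ?_
    filter_upwards [Lp.coeFn_smul c x] with r hr
    rw [hr, Pi.smul_apply, map_smul]; rfl
  · have h0 : eLpNorm (fun r => b r (x r)) Q μ ≤ ENNReal.ofReal C * (eLpNorm x P μ * K) :=
      (eLpNorm_le_mul_eLpNorm_of_ae_le_mul (hbd x) Q).trans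
        (mul_le_mul_right (eLpNorm_le_eLpNorm_mul_rpow_measure_univ hP
          (Lp.aestronglyMeasurable x)) _)
    change ‖(hmem x).toLp _‖ ≤ _
    rw [Lp.norm_toLp, Lp.norm_def]
    calc _ ≤ (ENNReal.ofReal C * (eLpNorm x P μ * K)).toReal :=
          ENNReal.toReal_mono (ENNReal.mul_ne_top ENNReal.ofReal_ne_top
            (ENNReal.mul_ne_top (Lp.eLpNorm_ne_top x) hKtop)) h0
      _ = _ := by
        rw [ENNReal.toReal_mul, ENNReal.toReal_mul, ENNReal.toReal_ofReal hC0]; ring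

theorem continuous_integral_clm_apply [NormedSpace ℝ F] [CompleteSpace G] [IsFiniteMeasure μ]
    {P : ℝ≥0∞} [hP : Fact (1 ≤ P)] {b : α → F →L[ℝ] G} (hb : AEStronglyMeasurable b μ) {C : ℝ}
    (hC : ∀ᵐ r ∂μ, ‖b r‖ ≤ C) : Continuous fun x : Lp F P μ => ∫ r, b r (x r) ∂μ := by
  obtain ⟨T, hT⟩ := exists_clm_Lp (P := P) (Q := 1) hP.out hb hC
  have h : (fun x : Lp F P μ => ∫ r, b r (x r) ∂μ) = fun x => ∫ r, T x r ∂μ :=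
    funext fun x => integral_congr_ae (hT x).symm
  rw [h]
  exact continuous_integral.comp T.continuous

/-- Fatou's lemma along an a.e. convergent subsequence. Since `q` is unrelated to `P`, the integral
may be infinite and continuity cannot be expected. -/
theorem lowerSemicontinuous_lintegral_enorm_rpow {P : ℝ≥0∞} [Fact (1 ≤ P)] {q : ℝ} :
    LowerSemicontinuous fun x : Lp F P μ => ∫⁻ r, ‖x r‖ₑ ^ q ∂μ := by
  rw [lowerSemicontinuous_iff_isClosed_preimage]
  refine fun c => IsSeqClosed.isClosed fun x z hx hz => ?_
  obtain ⟨ns, -, hns⟩ := (tendstoInMeasure_of_tendsto_Lp hz).exists_seq_tendsto_ae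
  have hlim : ∀ᵐ r ∂μ, ‖z r‖ₑ ^ q = liminf (fun k => ‖x (ns k) r‖ₑ ^ q) atTop := by
    filter_upwards [hns] with r hr
    exact (((ENNReal.continuous_rpow_const.tendsto _).comp hr.enorm).liminf_eq).symm
  change ∫⁻ r, ‖z r‖ₑ ^ q ∂μ ≤ c
  rw [lintegral_congr_ae hlim]
  refine (lintegral_liminf_le' fun k =>
    ((Lp.aestronglyMeasurable _).enorm.pow_const q)).trans ?_
  exact liminf_le_of_frequently_le' (Frequently.of_forall fun k => hx (ns k))

/-- The parallelogram law is the case `p = 2`. The general case follows because `s ↦ s ^ (p / 2)` is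
superadditive and convex on `[0, ∞)`. -/
theorem norm_midpoint_rpow_add_le {p : ℝ} (hp : 2 ≤ p) (x y : H) :
    ‖midpoint ℝ x y‖ ^ p + ‖(2 : ℝ)⁻¹ • (x - y)‖ ^ p ≤ (‖x‖ ^ p + ‖y‖ ^ p) / 2 := by
  have hp2 : 1 ≤ p / 2 := by linarith
  have hpow : ∀ z : H, ‖z‖ ^ p = (‖z‖ ^ 2) ^ (p / 2) := fun z => by
    rw [← Real.rpow_natCast_mul (norm_nonneg _)]; congr 1; push_cast; ring
  have hpar : ‖midpoint ℝ x y‖ ^ 2 + ‖(2 : ℝ)⁻¹ • (x - y)‖ ^ 2 =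
      (2 : ℝ)⁻¹ * ‖x‖ ^ 2 + (2 : ℝ)⁻¹ * ‖y‖ ^ 2 := by
    have h := parallelogram_law_with_norm ℝ x y
    rw [midpoint_eq_smul_add, norm_smul, norm_smul, mul_pow, mul_pow, invOf_eq_inv]
    norm_num
    nlinarith
  have hadd : ∀ s t : ℝ, 0 ≤ s → 0 ≤ t → s ^ (p / 2) + t ^ (p / 2) ≤ (s + t) ^ (p / 2) :=
    fun s t hs ht => by
      have := NNReal.add_rpow_le_rpow_add ⟨s, hs⟩ ⟨t, ht⟩ hp2
      exact_mod_cast this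
  simp only [hpow]
  refine (hadd _ _ (by positivity) (by positivity)).trans ?_
  rw [hpar]
  have h := (convexOn_rpow hp2).2 (show ‖x‖ ^ 2 ∈ Set.Ici (0 : ℝ) from sq_nonneg (_ : ℝ))
    (show ‖y‖ ^ 2 ∈ Set.Ici (0 : ℝ) from sq_nonneg (_ : ℝ)) (show (0 : ℝ) ≤ 2⁻¹ by norm_num)
    (show (0 : ℝ) ≤ 2⁻¹ by norm_num) (by norm_num)
  simp only [smul_eq_mul] at h
  linarith

theorem integrable_norm_rpow_of_memLp {p : ℝ} (hp : 0 < p) {g : α → F}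
    (hg : MemLp g (ENNReal.ofReal p) μ) : Integrable (fun r => ‖g r‖ ^ p) μ := by
  have := hg.integrable_norm_rpow (by simpa using hp) ENNReal.ofReal_ne_top
  rwa [ENNReal.toReal_ofReal hp.le] at this

theorem Lp_norm_rpow_eq_integral {p : ℝ} (hp : 0 < p) (x : Lp F (ENNReal.ofReal p) μ) :
    ‖x‖ ^ p = ∫ r, ‖x r‖ ^ p ∂μ := by
  rw [Lp.norm_def, (Lp.memLp x).eLpNorm_eq_integral_rpow_norm (by simpa using hp)
    ENNReal.ofReal_ne_top, ENNReal.toReal_ofReal hp.le, ENNReal.toReal_ofReal (by positivity),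
    Real.rpow_inv_rpow (by positivity) hp.ne']

/-- Clarkson's inequality in `Lp` of Hilbert space valued functions. -/
theorem Lp_norm_midpoint_rpow_add_le {p : ℝ} (hp : 2 ≤ p) [Fact (1 ≤ ENNReal.ofReal p)]
    (x y : Lp H (ENNReal.ofReal p) μ) :
    ‖midpoint ℝ x y‖ ^ p + ‖(2 : ℝ)⁻¹ • (x - y)‖ ^ p ≤ (‖x‖ ^ p + ‖y‖ ^ p) / 2 := by
  have hp0 : 0 < p := by linarith
  have hi : ∀ z : Lp H (ENNReal.ofReal p) μ, Integrable (fun r => ‖z r‖ ^ p) μ := fun z =>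
    integrable_norm_rpow_of_memLp hp0 (Lp.memLp z)
  simp only [Lp_norm_rpow_eq_integral hp0]
  rw [← integral_add (hi _) (hi _), ← integral_add (hi _) (hi _), ← integral_div]
  refine integral_mono_ae ((hi _).add (hi _)) (((hi _).add (hi _)).div_const 2) ?_
  rw [midpoint_eq_smul_add]
  filter_upwards [Lp.coeFn_add x y, Lp.coeFn_sub x y, Lp.coeFn_smul (⅟2 : ℝ) (x + y),
    Lp.coeFn_smul (2⁻¹ : ℝ) (x - y)] with r h1 h2 h3 h4
  have := norm_midpoint_rpow_add_le hp (x r) (y r)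
  rw [midpoint_eq_smul_add] at this
  rw [h3, h4, Pi.smul_apply, Pi.smul_apply, h1, h2]
  exact this

theorem norm_add_rpow_le [NormedSpace ℝ F] {q : ℝ} (hq : 1 ≤ q) {s t : ℝ} (hs : 0 ≤ s)
    (ht : 0 ≤ t) (hst : s + t = 1) (x y : F) :
    ‖s • x + t • y‖ ^ q ≤ s * ‖x‖ ^ q + t * ‖y‖ ^ q := by
  have h := (convexOn_rpow hq).2 (show ‖x‖ ∈ Set.Ici (0 : ℝ) from norm_nonneg _)
    (show ‖y‖ ∈ Set.Ici (0 : ℝ) from norm_nonneg _) hs ht hst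
  refine le_trans (Real.rpow_le_rpow (norm_nonneg _) ?_ (by linarith)) h
  refine (norm_add_le _ _).trans (le_of_eq ?_)
  simp [norm_smul, abs_of_nonneg hs, abs_of_nonneg ht]

theorem enorm_add_rpow_le [NormedSpace ℝ F] {q : ℝ} (hq : 1 ≤ q) {s t : ℝ} (hs : 0 ≤ s)
    (ht : 0 ≤ t) (hst : s + t = 1) (x y : F) : ‖s • x + t • y‖ₑ ^ q ≤
      ENNReal.ofReal s * ‖x‖ₑ ^ q + ENNReal.ofReal t * ‖y‖ₑ ^ q := by
  have hq0 : 0 ≤ q := by linarith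
  simp only [← ofReal_norm, ENNReal.ofReal_rpow_of_nonneg (norm_nonneg _) hq0]
  rw [← ENNReal.ofReal_mul hs, ← ENNReal.ofReal_mul ht,
    ← ENNReal.ofReal_add (by positivity) (by positivity)]
  exact ENNReal.ofReal_le_ofReal (norm_add_rpow_le hq hs ht hst x y)

theorem lintegral_enorm_add_rpow_le [NormedSpace ℝ F] {q : ℝ} (hq : 1 ≤ q)
    {s t : ℝ} (hs : 0 ≤ s) (ht : 0 ≤ t) (hst : s + t = 1) {g h : α → F} (hg : AEStronglyMeasurable g μ) :
    ∫⁻ r, ‖s • g r + t • h r‖ₑ ^ q ∂μ ≤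
      ENNReal.ofReal s * ∫⁻ r, ‖g r‖ₑ ^ q ∂μ + ENNReal.ofReal t * ∫⁻ r, ‖h r‖ₑ ^ q ∂μ := by
  rw [← lintegral_const_mul' _ _ ENNReal.ofReal_ne_top,
    ← lintegral_const_mul' _ _ ENNReal.ofReal_ne_top,
    ← lintegral_add_left' ((hg.enorm.pow_const q).const_mul _)]
  exact lintegral_mono fun r => enorm_add_rpow_le hq hs ht hst _ _

/-- The Gateaux derivative of `g ↦ ∫ ‖g‖ ^ q`. -/
theorem hasDerivAt_integral_norm_add_smul_rpow {q : ℝ} (hq : 1 < q) {g h : α → H}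
    (hg : MemLp g (ENNReal.ofReal q) μ) (hh : MemLp h (ENNReal.ofReal q) μ) :
    Integrable (fun r => q * ‖g r‖ ^ (q - 2) * inner ℝ (g r) (h r)) μ ∧
    HasDerivAt (fun t : ℝ => ∫ r, ‖g r + t • h r‖ ^ q ∂μ)
      (∫ r, q * ‖g r‖ ^ (q - 2) * inner ℝ (g r) (h r) ∂μ) 0 := by
  have hq0 : 0 < q := by linarith
  have hmem : ∀ t : ℝ, MemLp (fun r => g r + t • h r) (ENNReal.ofReal q) μ := fun t =>
    hg.add (hh.const_smul t)
  have hsum : MemLp (fun r => ‖g r‖ + ‖h r‖) (ENNReal.ofReal q) μ := hg.norm.add hh.norm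
  have hbint : Integrable (fun r => q * ‖‖g r‖ + ‖h r‖‖ ^ q) μ :=
    (integrable_norm_rpow_of_memLp hq0 hsum).const_mul q
  have hmeas : ∀ t : ℝ, AEStronglyMeasurable
      (fun r => q * ‖g r + t • h r‖ ^ (q - 2) * inner ℝ (g r + t • h r) (h r)) μ := fun t =>
    (((hmem t).1.norm.aemeasurable.pow_const (q - 2)).aestronglyMeasurable.const_mul q).mul
      ((hmem t).1.inner hh.1)
  -- For `|t| < 1` the derivative of the integrand is dominated by `q (‖g‖ + ‖h‖) ^ q`.
  have := hasDerivAt_integral_of_dominated_loc_of_deriv_le (μ := μ) (x₀ := (0 : ℝ))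
    (F := fun t r => ‖g r + t • h r‖ ^ q)
    (F' := fun t r => q * ‖g r + t • h r‖ ^ (q - 2) * inner ℝ (g r + t • h r) (h r))
    (bound := fun r => q * ‖‖g r‖ + ‖h r‖‖ ^ q)
    (Metric.ball_mem_nhds 0 one_pos)
    (Eventually.of_forall fun t =>
      (integrable_norm_rpow_of_memLp hq0 (hmem t)).aestronglyMeasurable)
    (integrable_norm_rpow_of_memLp hq0 (hmem 0))
    (hmeas 0) (Eventually.of_forall fun r t ht => ?_) hbint
    (Eventually.of_forall fun r t ht => ?_)
  · simpa using this
  · rw [Metric.mem_ball, dist_zero_right, Real.norm_eq_abs] at ht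
    set z : H := g r + t • h r with hz
    have hzle : ‖z‖ ≤ ‖g r‖ + ‖h r‖ := by
      refine (norm_add_le _ _).trans ?_
      rw [norm_smul, Real.norm_eq_abs]
      nlinarith [norm_nonneg (h r)]
    have h1 : ‖q * ‖z‖ ^ (q - 2) * inner ℝ z (h r)‖ ≤ q * (‖z‖ ^ (q - 1) * ‖h r‖) := by
      rw [norm_mul, norm_mul, Real.norm_of_nonneg hq0.le,
        Real.norm_of_nonneg (by positivity : (0 : ℝ) ≤ ‖z‖ ^ (q - 2)), mul_assoc]
      refine mul_le_mul_of_nonneg_left ?_ hq0.le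
      -- This form of the power rule needs only `q - 1 ≠ 0`, so it covers `z = 0` even if `q < 2`.
      have h2 : ‖z‖ ^ (q - 1) = ‖z‖ ^ (q - 2) * ‖z‖ := by
        rw [← Real.rpow_add_one' (norm_nonneg _) (by linarith)]; ring_nf
      rw [h2, mul_assoc]
      exact mul_le_mul_of_nonneg_left (norm_inner_le_norm _ _) (by positivity)
    refine h1.trans (mul_le_mul_of_nonneg_left ?_ hq0.le)
    rw [Real.norm_of_nonneg (by positivity : 0 ≤ ‖g r‖ + ‖h r‖)]
    have h3 : (‖g r‖ + ‖h r‖) ^ q = (‖g r‖ + ‖h r‖) ^ (q - 1) * (‖g r‖ + ‖h r‖) := by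
      rw [← Real.rpow_add_one' (by positivity) (by linarith)]; ring_nf
    rw [h3]
    refine mul_le_mul (Real.rpow_le_rpow (norm_nonneg _) hzle (by linarith))
      (by linarith [norm_nonneg (g r)]) (norm_nonneg _) (by positivity)
  · have h1 : HasDerivAt (fun t : ℝ => g r + t • h r) (h r) t := by
      simpa using ((hasDerivAt_id t).smul_const (h r)).const_add (g r)
    have h2 := (hasFDerivAt_norm_rpow (g r + t • h r) hq).comp_hasDerivAt t h1
    exact h2

end Lp

end ASD

/-! ### Test functions, Poincaré's inequality and uniqueness of weak gradients -/

namespace ASD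

variable {n : ℕ} {Ω : Set (Rn n)} {φ ψ : Rn n → ℝ}

theorem gradient_add {x : Rn n} (hφ : DifferentiableAt ℝ φ x) (hψ : DifferentiableAt ℝ ψ x) :
    gradient (φ + ψ) x = gradient φ x + gradient ψ x := by
  simp only [gradient, fderiv_add hφ hψ, map_add]

theorem gradient_const_smul {x : Rn n} (c : ℝ) (hψ : DifferentiableAt ℝ ψ x) :
    gradient (c • ψ) x = c • gradient ψ x := by
  simp only [gradient, fderiv_const_smul hψ]
  exact (InnerProductSpace.toDual ℝ (Rn n)).symm.map_smulₛₗ c _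

theorem norm_gradient (ψ : Rn n → ℝ) (x : Rn n) : ‖gradient ψ x‖ = ‖fderiv ℝ ψ x‖ := by
  simp [gradient]

namespace IsTest

theorem continuous (hψ : IsTest Ω ψ) : Continuous ψ := hψ.1.continuous

theorem differentiable (hψ : IsTest Ω ψ) : Differentiable ℝ ψ := hψ.1.differentiable (by simp)

theorem continuous_fderiv (hψ : IsTest Ω ψ) : Continuous (fderiv ℝ ψ) :=
  hψ.1.continuous_fderiv (by simp)

theorem continuous_gradient (hψ : IsTest Ω ψ) : Continuous (gradient ψ) :=
  (InnerProductSpace.toDual ℝ (Rn n)).symm.continuous.comp hψ.continuous_fderiv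

theorem hasCompactSupport_gradient (hψ : IsTest Ω ψ) : HasCompactSupport (gradient ψ) :=
  (hψ.2.1.fderiv ℝ).comp_left (g := (InnerProductSpace.toDual ℝ (Rn n)).symm) (map_zero _)

theorem eq_zero (hψ : IsTest Ω ψ) {x : Rn n} (hx : x ∉ Ω) : ψ x = 0 :=
  image_eq_zero_of_notMem_tsupport fun h => hx (hψ.2.2 h)

theorem gradient_eq_zero (hψ : IsTest Ω ψ) {x : Rn n} (hx : x ∉ Ω) : gradient ψ x = 0 := by
  have : fderiv ℝ ψ x = 0 :=
    image_eq_zero_of_notMem_tsupport fun h => hx (hψ.2.2 (tsupport_fderiv_subset ℝ h))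
  simp [gradient, this]

theorem memLp (hψ : IsTest Ω ψ) (q : ℝ≥0∞) (μ : Measure (Rn n)) [IsFiniteMeasureOnCompacts μ] :
    MemLp ψ q μ := hψ.continuous.memLp_of_hasCompactSupport hψ.2.1

theorem memLp_gradient (hψ : IsTest Ω ψ) (q : ℝ≥0∞) (μ : Measure (Rn n))
    [IsFiniteMeasureOnCompacts μ] : MemLp (gradient ψ) q μ :=
  hψ.continuous_gradient.memLp_of_hasCompactSupport hψ.hasCompactSupport_gradient

theorem exists_bound (hψ : IsTest Ω ψ) : ∃ C, ∀ x, ‖ψ x‖ ≤ C :=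
  hψ.2.1.exists_bound_of_continuous hψ.continuous

theorem exists_bound_gradient (hψ : IsTest Ω ψ) : ∃ C, ∀ x, ‖gradient ψ x‖ ≤ C :=
  hψ.hasCompactSupport_gradient.exists_bound_of_continuous hψ.continuous_gradient

theorem zero : IsTest Ω (0 : Rn n → ℝ) :=
  ⟨contDiff_const, HasCompactSupport.zero, by simp⟩

theorem add (hφ : IsTest Ω φ) (hψ : IsTest Ω ψ) : IsTest Ω (φ + ψ) :=
  ⟨hφ.1.add hψ.1, hφ.2.1.add hψ.2.1,
    (tsupport_add _ _).trans (Set.union_subset hφ.2.2 hψ.2.2)⟩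

theorem const_smul (hψ : IsTest Ω ψ) (c : ℝ) : IsTest Ω (c • ψ) :=
  ⟨contDiff_const.smul hψ.1, hψ.2.1.smul_left (f := fun _ => c),
    (closure_mono (Function.support_const_smul_subset c ψ)).trans hψ.2.2⟩

theorem setIntegral_smul {F : Type*} [NormedAddCommGroup F] [NormedSpace ℝ F] (hψ : IsTest Ω ψ)
    (G : Rn n → F) : ∫ x in Ω, ψ x • G x = ∫ x, ψ x • G x :=
  setIntegral_eq_integral_of_forall_compl_eq_zero fun x hx => by simp [hψ.eq_zero hx]

theorem integrableOn_smul {F : Type*} [NormedAddCommGroup F] [NormedSpace ℝ F]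
    (hψ : IsTest Ω ψ) {G : Rn n → F} (hG : LocallyIntegrableOn G Ω) :
    IntegrableOn (fun x => ψ x • G x) Ω := by
  have h := (hG.integrableOn_compact_subset hψ.2.2 hψ.2.1).continuousOn_smul
    hψ.continuous.continuousOn hψ.2.1
  have h2 : Integrable (fun x => ψ x • G x) := by
    refine (integrableOn_iff_integrable_of_support_subset fun x hx => ?_).1 h
    exact subset_tsupport ψ (fun h0 => hx (by simp [h0]))
  exact h2.integrableOn

theorem hasWeakGradient (hψ : IsTest Ω ψ) : HasWeakGradient Ω ψ (gradient ψ) := by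
  refine ⟨hψ.continuous.locallyIntegrable.locallyIntegrableOn Ω,
    hψ.continuous_gradient.locallyIntegrable.locallyIntegrableOn Ω, fun η hη => ?_⟩
  rw [hψ.setIntegral_smul, hη.setIntegral_smul]
  have hi : ∀ {φ₁ φ₂ : Rn n → ℝ}, IsTest Ω φ₁ → IsTest Ω φ₂ →
      Integrable (fun x => φ₁ x • gradient φ₂ x) := fun {φ₁ φ₂} h₁ h₂ =>
    (h₁.continuous.smul h₂.continuous_gradient).integrable_of_hasCompactSupport
      h₁.2.1.smul_right
  -- Pairing with a fixed vector `v` reduces the identity to scalar integration by parts in the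
  -- direction `v`.
  refine ext_inner_left ℝ fun v => ?_
  rw [inner_neg_right, ← integral_inner (hi hψ hη), ← integral_inner (hi hη hψ)]
  have hin : ∀ {φ₁ φ₂ : Rn n → ℝ}, ∀ x, inner ℝ v (φ₁ x • gradient φ₂ x) =
      φ₁ x * fderiv ℝ φ₂ x v := fun {φ₁ φ₂} x => by
    rw [inner_smul_right, real_inner_comm, inner_gradient_left]
  simp only [hin]
  have hi' : ∀ {φ₁ φ₂ : Rn n → ℝ}, IsTest Ω φ₁ → IsTest Ω φ₂ →
      Integrable (fun x => φ₁ x * fderiv ℝ φ₂ x v) := fun {φ₁ φ₂} h₁ h₂ => by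
    have := (hi h₁ h₂).const_inner (𝕜 := ℝ) v
    simpa only [hin] using this
  rw [integral_mul_fderiv_eq_neg_fderiv_mul_of_integrable]
  · simp only [mul_comm]
  · simpa only [mul_comm] using hi' hη hψ
  · exact hi' hψ hη
  · exact (hψ.continuous.mul hη.continuous).integrable_of_hasCompactSupport hψ.2.1.mul_right
  · exact fun x _ => hψ.differentiable x
  · exact fun x _ => hη.differentiable x

/-- The Poincaré inequality in `Lᵖ`. -/
theorem integral_norm_rpow_le (hψ : IsTest Ω ψ) (hn : 1 ≤ n) {R : ℝ}
    (hR : Ω ⊆ Metric.closedBall 0 R) {p : ℝ} (hp : 1 < p) :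
    ∫ x in Ω, ‖ψ x‖ ^ p ≤ (p * R) ^ p * ∫ x in Ω, ‖gradient ψ x‖ ^ p := by
  have hp0 : 0 < p := by linarith
  rcases Ω.eq_empty_or_nonempty with rfl | ⟨x₀, hx₀⟩
  · simp
  have hR0 : 0 ≤ R := by
    have := hR hx₀
    rw [mem_closedBall_zero_iff] at this
    exact (norm_nonneg _).trans this
  rw [setIntegral_eq_integral_of_forall_compl_eq_zero (fun x hx => by
      simp [hψ.eq_zero hx, hp0.ne']),
    setIntegral_eq_integral_of_forall_compl_eq_zero (fun x hx => by
      simp [hψ.gradient_eq_zero hx, hp0.ne'])]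
  -- The coordinate `l` has derivative one along `e` and satisfies `|l| ≤ R` on `Ω`, so integration
  -- by parts gives `∫ |ψ|^p = -∫ ∂ₑ(|ψ|^p) l`.
  set i : Fin n := ⟨0, hn⟩
  set e : Rn n := EuclideanSpace.single i 1 with he
  set l : Rn n →L[ℝ] ℝ := EuclideanSpace.proj i with hl
  have hle : l e = 1 := by simp [hl, he]
  have hlx : ∀ x, |l x| ≤ ‖x‖ := fun x => by
    simpa [hl] using PiLp.norm_apply_le x i
  set g : Rn n → ℝ := fun x => ‖ψ x‖ ^ p with hg
  have hgC : ContDiff ℝ 1 g := (hψ.1.of_le (by simp)).norm_rpow hp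
  have hgs : HasCompactSupport g := hψ.2.1.comp_left (g := fun t : ℝ => ‖t‖ ^ p) (by simp [hp0.ne'])
  have hgt : ∀ x, x ∉ Ω → fderiv ℝ g x = 0 := fun x hx => by
    rw [hψ.differentiable.fderiv_norm_rpow hp, hψ.eq_zero hx]; simp
  have hgd : Continuous (fderiv ℝ g) := hgC.continuous_fderiv one_ne_zero
  have hgdi : Continuous fun x => fderiv ℝ g x e * l x :=
    (hgd.clm_apply continuous_const).mul l.continuous
  have hparts : ∫ x, g x * fderiv ℝ l x e = -∫ x, fderiv ℝ g x e * l x := by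
    refine integral_mul_fderiv_eq_neg_fderiv_mul_of_integrable ?_ ?_ ?_
      (fun x _ => hgC.differentiable one_ne_zero x) (fun x _ => l.differentiableAt)
    · exact hgdi.integrable_of_hasCompactSupport ((hgs.fderiv_apply ℝ e).mul_right)
    · simpa only [ContinuousLinearMap.fderiv, hle, mul_one] using
        hgC.continuous.integrable_of_hasCompactSupport hgs
    · exact (hgC.continuous.mul l.continuous).integrable_of_hasCompactSupport hgs.mul_right
  simp only [ContinuousLinearMap.fderiv, hle, mul_one] at hparts
  have hgi : Integrable g := hgC.continuous.integrable_of_hasCompactSupport hgs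
  have hGi : Integrable fun x => ‖gradient ψ x‖ ^ p :=
    integrable_norm_rpow_of_memLp hp0 (hψ.memLp_gradient _ volume)
  have hpq : (p / (p - 1)).HolderConjugate p := by
    have := (Real.HolderConjugate.conjExponent hp).symm
    simpa [Real.conjExponent] using this
  have hpt : ∀ x, -(fderiv ℝ g x e * l x) ≤
      (1 - 1 / p) * g x + (1 / p) * ((p * R) ^ p * ‖gradient ψ x‖ ^ p) := by
    intro x
    by_cases hx : x ∈ Ω
    · have h1 : ‖fderiv ℝ g x e‖ ≤ p * ‖ψ x‖ ^ (p - 1) * ‖gradient ψ x‖ := by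
        refine ((fderiv ℝ g x).le_opNorm e).trans ?_
        rw [he, PiLp.norm_single, norm_one, mul_one, norm_gradient]
        exact norm_fderiv_norm_rpow_le hψ.differentiable hp
      have h2 : |l x| ≤ R := (hlx x).trans (by simpa using hR hx)
      have h3 : -(fderiv ℝ g x e * l x) ≤ ‖ψ x‖ ^ (p - 1) * (p * R * ‖gradient ψ x‖) := by
        refine (neg_le_abs _).trans ?_
        rw [abs_mul]
        calc _ ≤ (p * ‖ψ x‖ ^ (p - 1) * ‖gradient ψ x‖) * R :=
              mul_le_mul h1 h2 (abs_nonneg _) (by positivity)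
          _ = _ := by ring
      -- Young's inequality with exponents `p / (p - 1)` and `p` leaves the coefficient `1 - 1 / p`
      -- in front of `|ψ|^p`, which the left side absorbs after integration.
      have h4 := Real.young_inequality_of_nonneg (a := ‖ψ x‖ ^ (p - 1))
        (b := p * R * ‖gradient ψ x‖) (by positivity) (by positivity) hpq
      have h5 : (‖ψ x‖ ^ (p - 1)) ^ (p / (p - 1)) = g x := by
        rw [← Real.rpow_mul (norm_nonneg _), mul_div_cancel₀ _ (by linarith)]
      rw [h5, Real.mul_rpow (by positivity) (norm_nonneg _)] at h4
      refine h3.trans (h4.trans (le_of_eq ?_))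
      have : p - 1 ≠ 0 := by linarith
      field_simp
    · have h1 : 0 ≤ 1 - 1 / p := by
        rw [sub_nonneg, div_le_one hp0]; exact hp.le
      rw [hgt x hx]
      simp only [zero_apply, zero_mul, neg_zero]
      have h2 : 0 ≤ g x := by positivity
      positivity
  have hle2 : ∫ x, g x ≤
      (1 - 1 / p) * (∫ x, g x) + (1 / p) * ((p * R) ^ p * ∫ x, ‖gradient ψ x‖ ^ p) := by
    conv_lhs => rw [hparts, ← integral_neg]
    rw [← integral_const_mul, ← integral_const_mul, ← integral_const_mul, ← integral_add]
    · exact integral_mono (hgdi.integrable_of_hasCompactSupport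
        ((hgs.fderiv_apply ℝ e).mul_right)).neg
        ((hgi.const_mul _).add ((hGi.const_mul _).const_mul _)) hpt
    · exact hgi.const_mul _
    · exact (hGi.const_mul _).const_mul _
  have h6 : (1 / p) * ∫ x, g x ≤ (1 / p) * ((p * R) ^ p * ∫ x, ‖gradient ψ x‖ ^ p) := by
    linarith
  exact le_of_mul_le_mul_left h6 (by positivity)

end IsTest

/-- The fundamental lemma of the calculus of variations. It makes the choice in `weakGradient`
harmless. -/
theorem HasWeakGradient.ae_eq (hΩ : IsOpen Ω) {u : Rn n → ℝ} {G G' : Rn n → Rn n}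
    (h : HasWeakGradient Ω u G) (h' : HasWeakGradient Ω u G') :
    G =ᵐ[volume.restrict Ω] G' := by
  have h0 := hΩ.ae_eq_zero_of_integral_contDiff_smul_eq_zero (μ := volume)
    (h.2.1.sub h'.2.1) fun ψ h1 h2 h3 => by
      have hψ : IsTest Ω ψ := ⟨h1, h2, h3⟩
      rw [← hψ.setIntegral_smul]
      simp only [Pi.sub_apply, smul_sub]
      rw [integral_sub (hψ.integrableOn_smul h.2.1) (hψ.integrableOn_smul h'.2.1)]
      have e1 := h.2.2 ψ hψ
      have e2 := h'.2.2 ψ hψ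
      rw [e1] at e2
      rw [neg_inj.1 e2, sub_self]
  rw [EventuallyEq, ae_restrict_iff' hΩ.measurableSet]
  filter_upwards [h0] with x hx hxΩ
  exact sub_eq_zero.1 (hx hxΩ)

theorem HasWeakGradient.weakGradient_ae_eq (hΩ : IsOpen Ω) {u : Rn n → ℝ} {G : Rn n → Rn n}
    (h : HasWeakGradient Ω u G) : weakGradient Ω u =ᵐ[volume.restrict Ω] G := by
  have hex : ∃ G, HasWeakGradient Ω u G := ⟨G, h⟩
  have : weakGradient Ω u = hex.choose := by simp only [weakGradient, dif_pos hex]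
  rw [this]
  exact hex.choose_spec.ae_eq hΩ h

theorem HasWeakGradient.congr {u u' : Rn n → ℝ} {G : Rn n → Rn n}
    (h : HasWeakGradient Ω u G) (hu : u =ᵐ[volume.restrict Ω] u') :
    HasWeakGradient Ω u' G := by
  refine ⟨h.1.congr hu, h.2.1, fun ψ hψ => ?_⟩
  rw [← h.2.2 ψ hψ]
  refine integral_congr_ae ?_
  filter_upwards [hu] with x hx
  rw [hx]

end ASD

/-! ### The space `W₀^{1,p}` as a closed subspace of pairs -/

namespace ASD

section Bilinear

variable {α F G K : Type*} [MeasurableSpace α] {μ : Measure α} [IsFiniteMeasure μ]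
  [NormedAddCommGroup F] [NormedSpace ℝ F] [NormedAddCommGroup G] [NormedSpace ℝ G]
  [NormedAddCommGroup K] [NormedSpace ℝ K]

theorem exists_clm_Lp_bilin {P Q : ℝ≥0∞} [Fact (1 ≤ P)] [Fact (1 ≤ Q)] (hP : Q ≤ P)
    (L : K →L[ℝ] F →L[ℝ] G) {g : α → K} (hg : AEStronglyMeasurable g μ) {C : ℝ}
    (hC : ∀ᵐ r ∂μ, ‖g r‖ ≤ C) :
    ∃ T : Lp F P μ →L[ℝ] Lp G Q μ, ∀ x, T x =ᵐ[μ] fun r => L (g r) (x r) :=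
  exists_clm_Lp hP (L.continuous.comp_aestronglyMeasurable hg) (C := ‖L‖ * C) <| by
    filter_upwards [hC] with r hr
    exact L.le_opNorm_of_le hr

theorem continuous_integral_bilin [CompleteSpace G] {P : ℝ≥0∞} [Fact (1 ≤ P)]
    (L : K →L[ℝ] F →L[ℝ] G) {g : α → K} (hg : AEStronglyMeasurable g μ) {C : ℝ}
    (hC : ∀ᵐ r ∂μ, ‖g r‖ ≤ C) : Continuous fun x : Lp F P μ => ∫ r, L (g r) (x r) ∂μ :=
  continuous_integral_clm_apply (L.continuous.comp_aestronglyMeasurable hg) (C := ‖L‖ * C) <| by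
    filter_upwards [hC] with r hr
    exact L.le_opNorm_of_le hr

end Bilinear

variable {n : ℕ}

/-- The pairs of an `Lᵖ` function and an `Lᵖ` vector field on `Ω`. -/
abbrev LpPair (Ω : Set (Rn n)) (p : ℝ) : Type :=
  Lp ℝ (ENNReal.ofReal p) (volume.restrict Ω) × Lp (Rn n) (ENNReal.ofReal p) (volume.restrict Ω)

/-- The pairs `(ψ, ∇ψ)` with `ψ` a test function. -/
noncomputable def testPairs (Ω : Set (Rn n)) (p : ℝ) : Submodule ℝ (LpPair Ω p) where
  carrier := {x | ∃ ψ, IsTest Ω ψ ∧ x.1 =ᵐ[volume.restrict Ω] ψ ∧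
    x.2 =ᵐ[volume.restrict Ω] gradient ψ}
  zero_mem' := by
    refine ⟨0, IsTest.zero, Lp.coeFn_zero _ _ _, ?_⟩
    have : gradient (0 : Rn n → ℝ) = 0 := gradient_const' 0
    rw [this]
    exact Lp.coeFn_zero _ _ _
  add_mem' := by
    rintro x y ⟨φ, hφ, hx1, hx2⟩ ⟨ψ, hψ, hy1, hy2⟩
    refine ⟨φ + ψ, hφ.add hψ, (Lp.coeFn_add _ _).trans (hx1.add hy1),
      (Lp.coeFn_add _ _).trans ?_⟩
    filter_upwards [hx2, hy2] with r h1 h2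
    rw [Pi.add_apply, h1, h2, gradient_add (hφ.differentiable r) (hψ.differentiable r)]
  smul_mem' := by
    rintro c x ⟨ψ, hψ, hx1, hx2⟩
    refine ⟨c • ψ, hψ.const_smul c, (Lp.coeFn_smul _ _).trans (hx1.const_smul c),
      (Lp.coeFn_smul _ _).trans ?_⟩
    filter_upwards [hx2] with r h1
    rw [Pi.smul_apply, h1, gradient_const_smul c (hψ.differentiable r)]

/-- The pairs `(u, ∇u)` with `u ∈ W₀^{1,p}(Ω)`. -/
noncomputable def sobolevPairs (Ω : Set (Rn n)) (p : ℝ) [Fact (1 ≤ ENNReal.ofReal p)] :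
    Submodule ℝ (LpPair Ω p) := (testPairs Ω p).topologicalClosure

variable {Ω : Set (Rn n)} {p : ℝ}

theorem IsTest.toLp_mem_testPairs {ψ : Rn n → ℝ} (hψ : IsTest Ω ψ) :
    ((hψ.memLp (ENNReal.ofReal p) (volume.restrict Ω)).toLp ψ,
      (hψ.memLp_gradient (ENNReal.ofReal p) (volume.restrict Ω)).toLp (gradient ψ)) ∈
      testPairs Ω p :=
  ⟨ψ, hψ, (hψ.memLp _ _).coeFn_toLp, (hψ.memLp_gradient _ _).coeFn_toLp⟩

variable [Fact (1 ≤ ENNReal.ofReal p)]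

theorem testPairs_le_sobolevPairs : testPairs Ω p ≤ sobolevPairs Ω p :=
  Submodule.le_topologicalClosure _

theorem isClosed_sobolevPairs : IsClosed (sobolevPairs Ω p : Set (LpPair Ω p)) :=
  Submodule.isClosed_topologicalClosure _

/-- Density of test pairs: Poincaré's inequality, the weak gradient identity and skewness all pass
to the closure through this principle. -/
theorem sobolevPairs_induction {motive : LpPair Ω p → Prop} (hclosed : IsClosed {x | motive x})
    (htest : ∀ x ∈ testPairs Ω p, motive x) {x : LpPair Ω p} (hx : x ∈ sobolevPairs Ω p) :
    motive x := by
  have hx' : x ∈ closure (testPairs Ω p : Set (LpPair Ω p)) := by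
    rwa [← Submodule.topologicalClosure_coe]
  exact closure_minimal (t := {x | motive x}) htest hclosed hx'

/-- Poincaré's inequality on the closure. It lets the gradient component alone control the norm of a
pair. -/
theorem norm_fst_le_of_mem_sobolevPairs (hn : 1 ≤ n) {R : ℝ} (hR0 : 0 ≤ R)
    (hR : Ω ⊆ Metric.closedBall 0 R) (hp : 1 < p) {x : LpPair Ω p} (hx : x ∈ sobolevPairs Ω p) :
    ‖x.1‖ ≤ p * R * ‖x.2‖ := by
  have hp0 : 0 < p := by linarith
  refine sobolevPairs_induction (motive := fun x : LpPair Ω p => ‖x.1‖ ≤ p * R * ‖x.2‖)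
    (isClosed_le (by fun_prop) (by fun_prop)) ?_ hx
  rintro x ⟨ψ, hψ, h1, h2⟩
  rw [← Real.rpow_le_rpow_iff (norm_nonneg _) (by positivity) hp0,
    Real.mul_rpow (by positivity) (norm_nonneg _), Lp_norm_rpow_eq_integral hp0,
    Lp_norm_rpow_eq_integral hp0]
  convert hψ.integral_norm_rpow_le hn hR hp using 1
  · refine integral_congr_ae ?_
    filter_upwards [h1] with r hr
    rw [hr]
  · congr 1
    refine integral_congr_ae ?_
    filter_upwards [h2] with r hr
    rw [hr]

section Finite

variable [IsFiniteMeasure (volume.restrict Ω)]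

theorem Lp_integrable {F : Type*} [NormedAddCommGroup F]
    (x : Lp F (ENNReal.ofReal p) (volume.restrict Ω)) : Integrable x (volume.restrict Ω) :=
  (Lp.memLp x).integrable (Fact.out : 1 ≤ ENNReal.ofReal p)

/-- For fixed `ψ` both sides of the defining identity are continuous in the pair, since `ψ` and `∇ψ`
are bounded and the measure is finite. -/
theorem hasWeakGradient_of_mem_sobolevPairs {x : LpPair Ω p} (hx : x ∈ sobolevPairs Ω p) :
    HasWeakGradient Ω x.1 x.2 := by
  refine ⟨IntegrableOn.locallyIntegrableOn (Lp_integrable x.1),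
    IntegrableOn.locallyIntegrableOn (Lp_integrable x.2),
    fun ψ hψ => ?_⟩
  refine sobolevPairs_induction (motive := fun x : LpPair Ω p =>
    ∫ r in Ω, x.1 r • gradient ψ r = -∫ r in Ω, ψ r • x.2 r) ?_ ?_ hx
  · obtain ⟨C₁, hC₁⟩ := hψ.exists_bound
    obtain ⟨C₂, hC₂⟩ := hψ.exists_bound_gradient
    have h1 := continuous_integral_bilin (P := ENNReal.ofReal p) (μ := volume.restrict Ω)
      (ContinuousLinearMap.lsmul ℝ ℝ : ℝ →L[ℝ] Rn n →L[ℝ] Rn n).flip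
      hψ.continuous_gradient.aestronglyMeasurable (Eventually.of_forall hC₂)
    have h2 := continuous_integral_bilin (P := ENNReal.ofReal p) (μ := volume.restrict Ω)
      (ContinuousLinearMap.lsmul ℝ ℝ : ℝ →L[ℝ] Rn n →L[ℝ] Rn n)
      hψ.continuous.aestronglyMeasurable (Eventually.of_forall hC₁)
    exact isClosed_eq (h1.comp continuous_fst) (h2.comp continuous_snd).neg
  · rintro x ⟨φ, hφ, h1, h2⟩
    have := hφ.hasWeakGradient.2.2 ψ hψ
    convert this using 1
    · refine integral_congr_ae ?_
      filter_upwards [h1] with r hr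
      rw [hr]
    · congr 1
      refine integral_congr_ae ?_
      filter_upwards [h2] with r hr
      rw [hr]

theorem weakGradient_ae_eq_snd (hΩ : IsOpen Ω) {x : LpPair Ω p} (hx : x ∈ sobolevPairs Ω p)
    {u : Rn n → ℝ} (hu : x.1 =ᵐ[volume.restrict Ω] u) :
    weakGradient Ω u =ᵐ[volume.restrict Ω] x.2 :=
  ((hasWeakGradient_of_mem_sobolevPairs hx).congr hu).weakGradient_ae_eq hΩ

/-- The bridge from the sequential definition to the Banach space of pairs, in which closedness and
completeness are available. -/
theorem memW1p0_iff (hΩ : IsOpen Ω) {u : Rn n → ℝ} :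
    MemW1p0 Ω p u ↔ ∃ x ∈ sobolevPairs Ω p, x.1 =ᵐ[volume.restrict Ω] u := by
  constructor
  · rintro ⟨⟨hu, G, hG, hGp⟩, ψ, hψ, h1, h2⟩
    have hwp : MemLp (weakGradient Ω u) (ENNReal.ofReal p) (volume.restrict Ω) :=
      hGp.ae_eq (hG.weakGradient_ae_eq hΩ).symm
    refine ⟨(hu.toLp u, hwp.toLp _), ?_, hu.coeFn_toLp⟩
    have hmem : ((hu.toLp u, hwp.toLp _) : LpPair Ω p) ∈ closure (testPairs Ω p : Set (LpPair Ω p)) := by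
      refine mem_closure_of_tendsto (b := atTop)
        (f := fun k => (((hψ k).memLp (ENNReal.ofReal p) (volume.restrict Ω)).toLp (ψ k),
          ((hψ k).memLp_gradient (ENNReal.ofReal p) (volume.restrict Ω)).toLp (gradient (ψ k)))) ?_
        (Eventually.of_forall fun k => (hψ k).toLp_mem_testPairs)
      exact ((Lp.tendsto_Lp_iff_tendsto_eLpNorm'' _ _ _ _).2 h1).prodMk_nhds
        ((Lp.tendsto_Lp_iff_tendsto_eLpNorm'' _ _ _ _).2 h2)
    rwa [← Submodule.topologicalClosure_coe] at hmem
  · rintro ⟨x, hx, hxu⟩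
    have hw := weakGradient_ae_eq_snd hΩ hx hxu
    refine ⟨⟨(Lp.memLp x.1).ae_eq hxu, x.2, (hasWeakGradient_of_mem_sobolevPairs hx).congr hxu,
      Lp.memLp x.2⟩, ?_⟩
    have hx' : x ∈ closure (testPairs Ω p : Set (LpPair Ω p)) := by
      rwa [← Submodule.topologicalClosure_coe]
    obtain ⟨y, hy, hyx⟩ := mem_closure_iff_seq_limit.1 hx'
    choose ψ hψ h1 h2 using hy
    refine ⟨ψ, hψ, ?_, ?_⟩
    · refine ((Lp.tendsto_Lp_iff_tendsto_eLpNorm' _ _).1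
        ((continuous_fst.tendsto x).comp hyx)).congr fun k => ?_
      exact eLpNorm_congr_ae ((h1 k).sub hxu)
    · refine ((Lp.tendsto_Lp_iff_tendsto_eLpNorm' _ _).1
        ((continuous_snd.tendsto x).comp hyx)).congr fun k => ?_
      exact eLpNorm_congr_ae ((h2 k).sub hw.symm)

end Finite

end ASD

/-! ### The transport operator and its skew-symmetry -/

namespace ASD

variable {n : ℕ} {Ω : Set (Rn n)} {a : Rn n → Rn n}

/-- Near each point of the closure some continuous, hence locally bounded, family of derivatives
within the closure exists. It need not be unique at the boundary, but at points of `U` it is the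
full derivative. Compactness gives one bound. -/
theorem exists_forall_norm_fderiv_le_of_contDiffOn_closure {E F : Type*} [NormedAddCommGroup E]
    [NormedSpace ℝ E] [NormedAddCommGroup F] [NormedSpace ℝ F] {U : Set E} (hU : IsOpen U)
    (hUc : IsCompact (closure U)) {f : E → F} (hf : ContDiffOn ℝ 1 f (closure U)) :
    ∃ C, ∀ x ∈ U, ‖fderiv ℝ f x‖ ≤ C := by
  refine hUc.induction_on (p := fun s => ∃ C, ∀ x ∈ s ∩ U, ‖fderiv ℝ f x‖ ≤ C) (by simp)
    (fun s t hst ⟨C, hC⟩ => ⟨C, fun x hx => hC x ⟨hst hx.1, hx.2⟩⟩)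
    (fun s t ⟨C, hC⟩ ⟨C', hC'⟩ => ⟨max C C', fun x hx => ?_⟩) (fun x hx => ?_)
    |>.imp fun C hC x hx => hC x ⟨subset_closure hx, hx⟩
  · rcases hx.1 with h | h
    · exact (hC x ⟨h, hx.2⟩).trans (le_max_left _ _)
    · exact (hC' x ⟨h, hx.2⟩).trans (le_max_right _ _)
  · obtain ⟨u, hu, -, f', hf', hc⟩ :=
      (contDiffWithinAt_succ_iff_hasFDerivWithinAt (n := 0) (by simp)).1 (hf x hx)
    rw [Set.insert_eq_of_mem hx] at hu
    have hxu : x ∈ u := mem_of_mem_nhdsWithin hx hu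
    have hev : ∀ᶠ y in 𝓝[u] x, ‖f' y‖ < ‖f' x‖ + 1 :=
      hc.continuousWithinAt.norm.eventually_lt continuousWithinAt_const (by simp)
    obtain ⟨V, hV, hxV, hVu⟩ := mem_nhdsWithin.1 hu
    obtain ⟨W, hW, hxW, hWu⟩ := mem_nhdsWithin.1 hev
    refine ⟨V ∩ W, inter_mem (mem_nhdsWithin_of_mem_nhds (hV.mem_nhds hxV))
      (mem_nhdsWithin_of_mem_nhds (hW.mem_nhds hxW)), ‖f' x‖ + 1, ?_⟩
    rintro y ⟨⟨hyV, hyW⟩, hyU⟩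
    have huy : u ∈ 𝓝 y := by
      filter_upwards [hV.mem_nhds hyV, hU.mem_nhds hyU] with z hzV hzU
      exact hVu ⟨hzV, subset_closure hzU⟩
    have hyu : y ∈ u := mem_of_mem_nhds huy
    rw [((hf' y hyu).hasFDerivAt huy).fderiv]
    exact (hWu ⟨hyW, hyu⟩).le

theorem continuousOn_divergence (hΩ : IsOpen Ω) (ha : ContDiffOn ℝ ∞ a (closure Ω)) :
    ContinuousOn (divergence a) Ω := by
  have h := (ha.mono subset_closure).continuousOn_fderiv_of_isOpen hΩ (by simp)
  unfold divergence
  refine continuousOn_finsetSum _ fun i _ => ?_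
  exact (EuclideanSpace.proj (𝕜 := ℝ) i).continuous.comp_continuousOn
    (h.clm_apply continuousOn_const)

theorem exists_forall_norm_divergence_le (hΩ : IsOpen Ω) (hΩb : Bornology.IsBounded Ω)
    (ha : ContDiffOn ℝ ∞ a (closure Ω)) : ∃ C, ∀ x ∈ Ω, ‖divergence a x‖ ≤ C := by
  obtain ⟨C, hC⟩ := exists_forall_norm_fderiv_le_of_contDiffOn_closure hΩ
    hΩb.isCompact_closure (ha.of_le (by simp))
  refine ⟨∑ _i : Fin n, C, fun x hx => (norm_sum_le _ _).trans (Finset.sum_le_sum fun i _ => ?_)⟩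
  refine (PiLp.norm_apply_le _ i).trans (((fderiv ℝ a x).le_opNorm _).trans ?_)
  rw [PiLp.norm_single, norm_one, mul_one]
  exact hC x hx

theorem exists_forall_norm_le (hΩb : Bornology.IsBounded Ω)
    (ha : ContDiffOn ℝ ∞ a (closure Ω)) : ∃ C, ∀ x ∈ Ω, ‖a x‖ ≤ C :=
  (hΩb.isCompact_closure.exists_bound_of_continuousOn ha.continuousOn).imp
    fun _ hC x hx => hC x (subset_closure hx)

/-- The field is arbitrary outside `closure Ω`; there the product is smooth because it vanishes near
every point off the support of `ψ`. -/
theorem IsTest.mul_apply {ψ : Rn n → ℝ} (hψ : IsTest Ω ψ) (hΩ : IsOpen Ω)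
    (ha : ContDiffOn ℝ ∞ a (closure Ω)) (i : Fin n) : IsTest Ω fun x => ψ x * a x i := by
  have hsub : tsupport (fun x => ψ x * a x i) ⊆ tsupport ψ := tsupport_mul_subset_left
  refine ⟨contDiff_iff_contDiffAt.2 fun x => ?_, hψ.2.1.mul_right, hsub.trans hψ.2.2⟩
  by_cases hx : x ∈ Ω
  · exact hψ.1.contDiffAt.mul (((EuclideanSpace.proj (𝕜 := ℝ) i).contDiff.contDiffAt).comp x
      ((ha.mono subset_closure).contDiffAt (hΩ.mem_nhds hx)))
  · refine (contDiffAt_const (c := (0 : ℝ))).congr_of_eventuallyEq ?_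
    exact notMem_tsupport_iff_eventuallyEq.1 fun h => hx (hψ.2.2 (hsub h))

/-- The product rule for `div (ψ a)`, split into partial derivatives of the test functions `ψ aᵢ`.
-/
theorem sum_gradient_mul_apply {ψ : Rn n → ℝ} {x : Rn n} (hψ : DifferentiableAt ℝ ψ x)
    (ha : DifferentiableAt ℝ a x) :
    ∑ i, inner ℝ (gradient (fun x => ψ x * a x i) x) (EuclideanSpace.single i 1) =
      inner ℝ (a x) (gradient ψ x) + divergence a x * ψ x := by
  have hi : ∀ i, inner ℝ (gradient (fun x => ψ x * a x i) x) (EuclideanSpace.single i 1) =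
      a x i * gradient ψ x i + (fderiv ℝ a x (EuclideanSpace.single i 1)) i * ψ x := fun i => by
    have h1 : HasFDerivAt (fun x => a x i)
        ((EuclideanSpace.proj (𝕜 := ℝ) i).comp (fderiv ℝ a x)) x :=
      (EuclideanSpace.proj (𝕜 := ℝ) i).hasFDerivAt.comp x ha.hasFDerivAt
    have h2 : fderiv ℝ ψ x (EuclideanSpace.single i 1) = gradient ψ x i := by
      rw [← inner_gradient_left, EuclideanSpace.inner_single_right]
      simp
    have h3 : HasFDerivAt (fun x => ψ x * a x i) _ x := hψ.hasFDerivAt.mul h1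
    rw [inner_gradient_left, h3.fderiv]
    simp only [add_apply, smul_apply, ContinuousLinearMap.comp_apply, smul_eq_mul, h2]
    simp only [PiLp.proj_apply]
    ring
  simp only [hi, Finset.sum_add_distrib, divergence, Finset.sum_mul]
  congr 1
  rw [PiLp.inner_apply]
  exact Finset.sum_congr rfl fun i _ => by simp [mul_comm]

theorem IsTransport.unique (hΩ : IsOpen Ω) [IsFiniteMeasure (volume.restrict Ω)] {u g g' : L2 Ω}
    (h : IsTransport Ω a u g) (h' : IsTransport Ω a u g') : g = g' := by
  have hli : ∀ g : L2 Ω, LocallyIntegrableOn g Ω := fun g =>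
    IntegrableOn.locallyIntegrableOn ((Lp.memLp g).integrable (by norm_num))
  have h0 := hΩ.ae_eq_zero_of_integral_contDiff_smul_eq_zero (μ := volume)
    ((hli g).sub (hli g')) fun ψ h1 h2 h3 => by
      have hψ : IsTest Ω ψ := ⟨h1, h2, h3⟩
      rw [← hψ.setIntegral_smul]
      simp only [Pi.sub_apply, smul_sub]
      rw [integral_sub (hψ.integrableOn_smul (hli g)) (hψ.integrableOn_smul (hli g'))]
      have e1 := (h ψ hψ).trans (h' ψ hψ).symm
      simp only [smul_eq_mul, mul_comm (ψ _), e1, sub_self]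
  refine Lp.ext ?_
  rw [EventuallyEq, ae_restrict_iff' hΩ.measurableSet]
  filter_upwards [h0] with x hx hxΩ
  exact sub_eq_zero.1 (hx hxΩ)

theorem IsTransport.transport_eq (hΩ : IsOpen Ω) [IsFiniteMeasure (volume.restrict Ω)]
    {u g : L2 Ω} (h : IsTransport Ω a u g) : transport Ω a u = g := by
  have hex : ∃ g, IsTransport Ω a u g := ⟨g, h⟩
  have : transport Ω a u = hex.choose := by simp only [transport, dif_pos hex]
  rw [this]
  exact hex.choose_spec.unique hΩ h

section Sobolev

variable {p : ℝ} [Fact (1 ≤ ENNReal.ofReal p)] [IsFiniteMeasure (volume.restrict Ω)]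

/-- On pairs `(u, ∇u)` the first-order operator is multiplication by bounded coefficients, and `Lᵖ`
embeds in `L²` on a bounded set for `p ≥ 2`. -/
theorem exists_clm_transport (hΩ : IsOpen Ω) (hΩb : Bornology.IsBounded Ω)
    (ha : ContDiffOn ℝ ∞ a (closure Ω)) (hp : 2 ≤ ENNReal.ofReal p) :
    ∃ A : LpPair Ω p →L[ℝ] L2 Ω, ∀ x, A x =ᵐ[volume.restrict Ω] fun r =>
      inner ℝ (a r) (x.2 r) + (1 / 2) * divergence a r * x.1 r := by
  obtain ⟨C₁, hC₁⟩ := exists_forall_norm_le hΩb ha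
  obtain ⟨C₂, hC₂⟩ := exists_forall_norm_divergence_le hΩ hΩb ha
  obtain ⟨S, hS⟩ := exists_clm_Lp_bilin (μ := volume.restrict Ω) hp
    (innerSL ℝ : Rn n →L[ℝ] Rn n →L[ℝ] ℝ)
    ((ha.continuousOn.mono subset_closure).aestronglyMeasurable hΩ.measurableSet)
    (ae_restrict_of_forall_mem hΩ.measurableSet hC₁)
  obtain ⟨T, hT⟩ := exists_clm_Lp_bilin (μ := volume.restrict Ω) hp (ContinuousLinearMap.mul ℝ ℝ)
    ((continuousOn_divergence hΩ ha).aestronglyMeasurable hΩ.measurableSet)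
    (ae_restrict_of_forall_mem hΩ.measurableSet hC₂)
  refine ⟨S.comp (ContinuousLinearMap.snd ℝ _ _) +
    (1 / 2 : ℝ) • T.comp (ContinuousLinearMap.fst ℝ _ _), fun x => ?_⟩
  change S x.2 + (1 / 2 : ℝ) • T x.1 =ᵐ[volume.restrict Ω] _
  refine (Lp.coeFn_add _ _).trans ?_
  filter_upwards [hS x.2, hT x.1, Lp.coeFn_smul (1 / 2 : ℝ) (T x.1)] with r h1 h2 h3
  rw [Pi.add_apply, h1, h3, Pi.smul_apply, h2]
  simp only [ContinuousLinearMap.mul_apply', smul_eq_mul, mul_assoc]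
  rfl

/-- The `i`-th component of the weak gradient identity is tested with `ψ aᵢ`. Summation gives `∫ u
div (ψ a) = -∫ ψ a · ∇u`, and adding the zero-order term halves the divergence. -/
theorem isTransport_of_mem_sobolevPairs (hΩ : IsOpen Ω) (hΩb : Bornology.IsBounded Ω)
    (ha : ContDiffOn ℝ ∞ a (closure Ω)) {x : LpPair Ω p}
    (hx : x ∈ sobolevPairs Ω p) {u g : L2 Ω} (hu : x.1 =ᵐ[volume.restrict Ω] u)
    (hg : g =ᵐ[volume.restrict Ω] fun r =>
      inner ℝ (a r) (x.2 r) + (1 / 2) * divergence a r * x.1 r) :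
    IsTransport Ω a u g := by
  intro ψ hψ
  obtain ⟨C₁, hC₁⟩ := exists_forall_norm_le hΩb ha
  obtain ⟨C₂, hC₂⟩ := exists_forall_norm_divergence_le hΩ hΩb ha
  obtain ⟨C₃, hC₃⟩ := hψ.exists_bound
  obtain ⟨-, -, hw⟩ := hasWeakGradient_of_mem_sobolevPairs hx
  have hη := fun i => hψ.mul_apply hΩ ha i
  have hint1 : ∀ i, Integrable (fun r => x.1 r • gradient (fun x => ψ x * a x i) r)
      (volume.restrict Ω) := fun i => by
    obtain ⟨C, hC⟩ := (hη i).exists_bound_gradient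
    exact (Lp_integrable x.1).smul_bdd C (hη i).continuous_gradient.aestronglyMeasurable
      (Eventually.of_forall hC)
  have hint2 : ∀ i, Integrable (fun r => (ψ r * a r i) • x.2 r) (volume.restrict Ω) :=
    fun i => (hη i).integrableOn_smul (IntegrableOn.locallyIntegrableOn (Lp_integrable x.2))
  have hcomp : ∀ i, ∫ r in Ω, x.1 r * inner ℝ (gradient (fun x => ψ x * a x i) r)
        (EuclideanSpace.single i 1) = -∫ r in Ω, ψ r * (a r i * x.2 r i) := fun i => by
    have h1 := congrArg (inner ℝ (EuclideanSpace.single i (1 : ℝ))) (hw _ (hη i))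
    rw [inner_neg_right, ← integral_inner (hint1 i), ← integral_inner (hint2 i)] at h1
    convert h1 using 1
    · refine integral_congr_ae (Eventually.of_forall fun r => ?_)
      simp only [inner_smul_right, real_inner_comm]
    · congr 1
      refine integral_congr_ae (Eventually.of_forall fun r => ?_)
      simp [inner_smul_right, EuclideanSpace.inner_single_left, mul_assoc]
  have hsum : ∫ r in Ω, x.1 r * (inner ℝ (a r) (gradient ψ r) + divergence a r * ψ r) =
      -∫ r in Ω, ψ r * inner ℝ (a r) (x.2 r) := by
    have h1 : ∫ r in Ω, x.1 r * (inner ℝ (a r) (gradient ψ r) + divergence a r * ψ r) =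
        ∑ i, ∫ r in Ω, x.1 r * inner ℝ (gradient (fun x => ψ x * a x i) r)
          (EuclideanSpace.single i 1) := by
      rw [← integral_finsetSum]
      · refine setIntegral_congr_fun hΩ.measurableSet fun r hr => ?_
        simp only
        rw [← Finset.mul_sum, sum_gradient_mul_apply (hψ.differentiable r)
          (((ha.mono subset_closure).contDiffAt (hΩ.mem_nhds hr)).differentiableAt (by simp))]
      · intro i _
        have := (hint1 i).inner_const (𝕜 := ℝ) (EuclideanSpace.single i (1 : ℝ))
        simpa only [inner_smul_left, conj_trivial] using this
    have h2 : ∫ r in Ω, ψ r * inner ℝ (a r) (x.2 r) =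
        ∑ i, ∫ r in Ω, ψ r * (a r i * x.2 r i) := by
      rw [← integral_finsetSum]
      · refine integral_congr_ae (Eventually.of_forall fun r => ?_)
        simp only [PiLp.inner_apply, ← Finset.mul_sum]
        simp [mul_comm]
      · intro i _
        have := (hint2 i).inner_const (𝕜 := ℝ) (EuclideanSpace.single i (1 : ℝ))
        simpa [inner_smul_left, EuclideanSpace.inner_single_right, mul_assoc] using this
    rw [h1, h2, ← Finset.sum_neg_distrib]
    exact Finset.sum_congr rfl fun i _ => hcomp i
  have hmeas : AEStronglyMeasurable (divergence a) (volume.restrict Ω) :=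
    (continuousOn_divergence hΩ ha).aestronglyMeasurable hΩ.measurableSet
  have hI : Integrable (fun r => (1 / 2) * divergence a r * x.1 r * ψ r) (volume.restrict Ω) := by
    have h1 : Integrable (fun r => x.1 r * divergence a r) (volume.restrict Ω) :=
      (Lp_integrable x.1).mul_bdd hmeas (ae_restrict_of_forall_mem hΩ.measurableSet hC₂)
    have h2 := (h1.mul_bdd hψ.continuous.aestronglyMeasurable
      (Eventually.of_forall hC₃)).const_mul (1 / 2)
    refine h2.congr (Eventually.of_forall fun r => ?_)
    simp only; ring
  have hJ : Integrable (fun r => ψ r * inner ℝ (a r) (x.2 r)) (volume.restrict Ω) := by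
    have h1 : Integrable (fun r => inner ℝ (a r) (x.2 r)) (volume.restrict Ω) := by
      refine ((Lp_integrable x.2).norm.const_mul C₁).mono'
        (((ha.continuousOn.mono subset_closure).aestronglyMeasurable hΩ.measurableSet).inner
          (Lp.aestronglyMeasurable _)) ?_
      filter_upwards [ae_restrict_of_forall_mem hΩ.measurableSet hC₁] with r hr
      exact (norm_inner_le_norm _ _).trans (mul_le_mul_of_nonneg_right hr (norm_nonneg _))
    exact h1.bdd_mul hψ.continuous.aestronglyMeasurable (Eventually.of_forall hC₃)
  have hK : Integrable (fun r => x.1 r * (inner ℝ (a r) (gradient ψ r) + divergence a r * ψ r))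
      (volume.restrict Ω) := by
    obtain ⟨C₄, hC₄⟩ := hψ.exists_bound_gradient
    refine (Lp_integrable x.1).mul_bdd (c := C₁ * C₄ + C₂ * C₃) ?_ ?_
    · exact (((ha.continuousOn.mono subset_closure).aestronglyMeasurable hΩ.measurableSet).inner
        hψ.continuous_gradient.aestronglyMeasurable).add
        (hmeas.mul hψ.continuous.aestronglyMeasurable)
    · filter_upwards [ae_restrict_of_forall_mem hΩ.measurableSet hC₁,
        ae_restrict_of_forall_mem hΩ.measurableSet hC₂] with r h1 h2
      refine (norm_add_le _ _).trans (add_le_add ((norm_inner_le_norm _ _).trans ?_) ?_)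
      · exact mul_le_mul h1 (hC₄ r) (norm_nonneg _) ((norm_nonneg _).trans h1)
      · rw [norm_mul]
        exact mul_le_mul h2 (hC₃ r) (norm_nonneg _) ((norm_nonneg _).trans h2)
  calc ∫ r in Ω, g r * ψ r
      = ∫ r in Ω, (ψ r * inner ℝ (a r) (x.2 r) + (1 / 2) * divergence a r * x.1 r * ψ r) := by
        refine integral_congr_ae ?_
        filter_upwards [hg] with r hr
        rw [hr]; ring
    _ = -(∫ r in Ω, x.1 r * (inner ℝ (a r) (gradient ψ r) + divergence a r * ψ r)) +
          ∫ r in Ω, (1 / 2) * divergence a r * x.1 r * ψ r := by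
        rw [integral_add hJ hI, hsum, neg_neg]
    _ = -∫ r in Ω, u r * (inner ℝ (a r) (gradient ψ r) + (1 / 2) * divergence a r * ψ r) := by
        rw [neg_add_eq_sub, ← integral_sub hI hK, ← integral_neg]
        refine integral_congr_ae ?_
        filter_upwards [hu] with r hr
        rw [← hr]; ring

/-- When `y` is a test pair this is the distributional definition of `A x`, because the formal
adjoint is `-A`. Both sides are continuous in `y`, so only `y` has to be approximated. -/
theorem inner_transport_skew (hΩ : IsOpen Ω) (hΩb : Bornology.IsBounded Ω)
    (ha : ContDiffOn ℝ ∞ a (closure Ω)) {A : LpPair Ω p →L[ℝ] L2 Ω}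
    (hA : ∀ x, A x =ᵐ[volume.restrict Ω] fun r =>
      inner ℝ (a r) (x.2 r) + (1 / 2) * divergence a r * x.1 r)
    {ι : Lp ℝ (ENNReal.ofReal p) (volume.restrict Ω) →L[ℝ] L2 Ω}
    (hι : ∀ x, ι x =ᵐ[volume.restrict Ω] x) {x y : LpPair Ω p} (hx : x ∈ sobolevPairs Ω p)
    (hy : y ∈ sobolevPairs Ω p) : inner ℝ (A x) (ι y.1) = -inner ℝ (A y) (ι x.1) := by
  refine sobolevPairs_induction (motive := fun y : LpPair Ω p =>
    inner ℝ (A x) (ι y.1) = -inner ℝ (A y) (ι x.1))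
    (isClosed_eq (by fun_prop) (by fun_prop)) ?_ hy
  rintro y ⟨ψ, hψ, h1, h2⟩
  have ht := isTransport_of_mem_sobolevPairs hΩ hΩb ha hx (hι x.1).symm (hA x) ψ hψ
  rw [L2.inner_def, L2.inner_def]
  convert ht using 1
  · refine integral_congr_ae ?_
    filter_upwards [h1, hι y.1] with r e1 e2
    rw [e2, e1]; simp [mul_comm]
  · congr 1
    refine integral_congr_ae ?_
    filter_upwards [h1, h2, hA y] with r e1 e2 e3
    rw [e3, e1, e2]
    simp

end Sobolev

end ASD

/-! ### The energy on pairs and the variational inequality -/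

namespace ASD

variable {n : ℕ} {Ω : Set (Rn n)} {p m : ℝ}

theorem lintegral_zero_enorm_rpow (hm : 0 < m) :
    ∫⁻ r in Ω, ‖(0 : LpPair Ω p).1 r‖ₑ ^ m = 0 := by
  have : ∫⁻ r in Ω, ‖(0 : LpPair Ω p).1 r‖ₑ ^ m = ∫⁻ _ in Ω, 0 := by
    refine lintegral_congr_ae ?_
    filter_upwards [Lp.coeFn_zero ℝ (ENNReal.ofReal p) (volume.restrict Ω)] with r hr
    change ‖(0 : Lp ℝ (ENNReal.ofReal p) (volume.restrict Ω)) r‖ₑ ^ m = 0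
    rw [hr]
    simp [hm]
  rw [this, lintegral_zero]

theorem lintegral_combination_le (hm : 1 ≤ m) {s t : ℝ} (hs : 0 ≤ s) (ht : 0 ≤ t)
    (hst : s + t = 1) (x y : LpPair Ω p) :
    ∫⁻ r in Ω, ‖(s • x + t • y).1 r‖ₑ ^ m ≤
      ENNReal.ofReal s * (∫⁻ r in Ω, ‖x.1 r‖ₑ ^ m) +
        ENNReal.ofReal t * ∫⁻ r in Ω, ‖y.1 r‖ₑ ^ m := by
  refine le_trans (le_of_eq (lintegral_congr_ae ?_))
    (lintegral_enorm_add_rpow_le hm hs ht hst (Lp.aestronglyMeasurable x.1))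
  filter_upwards [Lp.coeFn_add (s • x.1) (t • y.1), Lp.coeFn_smul s x.1, Lp.coeFn_smul t y.1]
    with r h1 h2 h3
  change ‖(s • x.1 + t • y.1) r‖ₑ ^ m = _
  rw [h1, Pi.add_apply, h2, h3, Pi.smul_apply, Pi.smul_apply]

variable [Fact (1 ≤ ENNReal.ofReal p)]

/-- The part of the energy that is finite and continuous on `W₀^{1,p}(Ω)`. -/
noncomputable def regularEnergy
    (S ι : Lp ℝ (ENNReal.ofReal p) (volume.restrict Ω) →L[ℝ] L2 Ω) (f : L2 Ω)
    (x : LpPair Ω p) : ℝ :=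
  (1 / p) * ‖x.2‖ ^ p + (1 / 2) * ‖S x.1‖ ^ 2 + inner ℝ (ι x.1) f

/-- The energy on its effective domain. -/
noncomputable def finiteEnergy
    (S ι : Lp ℝ (ENNReal.ofReal p) (volume.restrict Ω) →L[ℝ] L2 Ω) (f : L2 Ω) (m : ℝ)
    (x : LpPair Ω p) : ℝ :=
  regularEnergy S ι f x + (1 / m) * (∫⁻ r in Ω, ‖x.1 r‖ₑ ^ m).toReal

/-- The effective domain of the energy. -/
def energyDomain (Ω : Set (Rn n)) (p m : ℝ) [Fact (1 ≤ ENNReal.ofReal p)] : Set (LpPair Ω p) :=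
  {x | x ∈ sobolevPairs Ω p ∧ ∫⁻ r in Ω, ‖x.1 r‖ₑ ^ m ≠ ⊤}

theorem continuous_regularEnergy (hp : 0 ≤ p)
    (S ι : Lp ℝ (ENNReal.ofReal p) (volume.restrict Ω) →L[ℝ] L2 Ω) (f : L2 Ω) :
    Continuous (regularEnergy S ι f : LpPair Ω p → ℝ) := by
  have h : Continuous fun x : LpPair Ω p => ‖x.2‖ ^ p :=
    continuous_snd.norm.rpow_const fun _ => Or.inr hp
  unfold regularEnergy
  fun_prop

theorem zero_mem_energyDomain (hm : 0 < m) : (0 : LpPair Ω p) ∈ energyDomain Ω p m :=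
  ⟨zero_mem _, by rw [lintegral_zero_enorm_rpow hm]; exact ENNReal.zero_ne_top⟩

theorem finiteEnergy_zero (hp : 0 < p) (hm : 0 < m)
    (S ι : Lp ℝ (ENNReal.ofReal p) (volume.restrict Ω) →L[ℝ] L2 Ω) (f : L2 Ω) :
    finiteEnergy S ι f m (0 : LpPair Ω p) = 0 := by
  rw [finiteEnergy, lintegral_zero_enorm_rpow hm]
  simp [regularEnergy, hp.ne']

theorem convexOn_finiteEnergy (hp : 1 ≤ p) (hm : 1 ≤ m)
    (S ι : Lp ℝ (ENNReal.ofReal p) (volume.restrict Ω) →L[ℝ] L2 Ω) (f : L2 Ω) :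
    ConvexOn ℝ (energyDomain Ω p m) (finiteEnergy S ι f m) := by
  have hfin : ∀ x ∈ energyDomain Ω p m, ∀ y ∈ energyDomain Ω p m, ∀ s t : ℝ,
      ENNReal.ofReal s * (∫⁻ r in Ω, ‖x.1 r‖ₑ ^ m) +
        ENNReal.ofReal t * ∫⁻ r in Ω, ‖y.1 r‖ₑ ^ m ≠ ⊤ := fun x hx y hy s t =>
    ENNReal.add_ne_top.2 ⟨ENNReal.mul_ne_top ENNReal.ofReal_ne_top hx.2,
      ENNReal.mul_ne_top ENNReal.ofReal_ne_top hy.2⟩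
  refine ⟨fun x hx y hy s t hs ht hst => ⟨?_, ?_⟩, fun x hx y hy s t hs ht hst => ?_⟩
  · exact (sobolevPairs Ω p).add_mem ((sobolevPairs Ω p).smul_mem s hx.1)
      ((sobolevPairs Ω p).smul_mem t hy.1)
  · exact ne_top_of_le_ne_top (hfin x hx y hy s t) (lintegral_combination_le hm hs ht hst x y)
  · have h1 := norm_add_rpow_le hp hs ht hst x.2 y.2
    have h2 := norm_add_rpow_le one_le_two hs ht hst (S x.1) (S y.1)
    simp only [Real.rpow_two] at h2
    have h3 := ENNReal.toReal_mono (hfin x hx y hy s t)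
      (lintegral_combination_le hm hs ht hst x y)
    rw [ENNReal.toReal_add (ENNReal.mul_ne_top ENNReal.ofReal_ne_top hx.2)
      (ENNReal.mul_ne_top ENNReal.ofReal_ne_top hy.2), ENNReal.toReal_mul, ENNReal.toReal_mul,
      ENNReal.toReal_ofReal hs, ENNReal.toReal_ofReal ht] at h3
    have e1 : (s • x + t • y).2 = s • x.2 + t • y.2 := rfl
    have e2 : S (s • x + t • y).1 = s • S x.1 + t • S y.1 := by simp
    have e3 : inner ℝ (ι (s • x + t • y).1) f = s * inner ℝ (ι x.1) f + t * inner ℝ (ι y.1) f := by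
      simp [inner_add_left, inner_smul_left]
    rw [← e1] at h1
    rw [← e2] at h2
    have h1' := mul_le_mul_of_nonneg_left h1 (show 0 ≤ 1 / p by positivity)
    have h3' := mul_le_mul_of_nonneg_left h3 (show 0 ≤ 1 / m by positivity)
    simp only [finiteEnergy, regularEnergy, smul_eq_mul, e3]
    linarith

/-- The domain is not assumed closed, and `toReal` sends `⊤` to zero. The condition is therefore
rewritten with the lower semicontinuous integral in `ℝ≥0∞`, which forces finiteness by itself. -/
theorem isClosed_finiteEnergy_le (hp : 0 ≤ p) (hm : 0 < m)
    (S ι : Lp ℝ (ENNReal.ofReal p) (volume.restrict Ω) →L[ℝ] L2 Ω) (f : L2 Ω)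
    {g : LpPair Ω p → ℝ} (hg : Continuous g) :
    IsClosed {x | x ∈ energyDomain Ω p m ∧ finiteEnergy S ι f m x ≤ g x} := by
  have hJ := continuous_regularEnergy hp S ι f
  have hK : LowerSemicontinuous fun x : LpPair Ω p => ∫⁻ r in Ω, ‖x.1 r‖ₑ ^ m :=
    lowerSemicontinuous_lintegral_enorm_rpow.comp continuous_fst
  have h1 : IsClosed {x : LpPair Ω p | ∫⁻ r in Ω, ‖x.1 r‖ₑ ^ m ≤
      ENNReal.ofReal (m * (g x - regularEnergy S ι f x))} :=
    (lowerSemicontinuous_iff_isClosed_epigraph.1 hK).preimage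
      (f := fun x => (x, ENNReal.ofReal (m * (g x - regularEnergy S ι f x))))
      (continuous_id.prodMk (ENNReal.continuous_ofReal.comp (by fun_prop)))
  -- This second condition excludes negative differences, which `ENNReal.ofReal` would truncate to
  -- zero.
  have h2 : IsClosed {x : LpPair Ω p | regularEnergy S ι f x ≤ g x} := isClosed_le hJ hg
  have h3 := isClosed_sobolevPairs.inter (h1.inter h2)
  convert h3 using 1
  ext x
  simp only [Set.mem_ofPred_eq, Set.mem_inter_iff, SetLike.mem_coe, energyDomain, finiteEnergy]
  constructor
  · rintro ⟨⟨hx, hfin⟩, hle⟩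
    have h4 : (1 / m) * (∫⁻ r in Ω, ‖x.1 r‖ₑ ^ m).toReal ≤ g x - regularEnergy S ι f x := by
      linarith
    have h5 : 0 ≤ (1 / m) * (∫⁻ r in Ω, ‖x.1 r‖ₑ ^ m).toReal := by positivity
    refine ⟨hx, ?_, by linarith⟩
    rw [← ENNReal.ofReal_toReal hfin]
    refine ENNReal.ofReal_le_ofReal ?_
    rw [one_div, inv_mul_le_iff₀ hm] at h4
    exact h4
  · rintro ⟨hx, hle, hge⟩
    refine ⟨⟨hx, ne_top_of_le_ne_top ENNReal.ofReal_ne_top hle⟩, ?_⟩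
    have h4 := ENNReal.toReal_mono ENNReal.ofReal_ne_top hle
    rw [ENNReal.toReal_ofReal (mul_nonneg hm.le (sub_nonneg.2 hge))] at h4
    have h5 : (1 / m) * (∫⁻ r in Ω, ‖x.1 r‖ₑ ^ m).toReal ≤ g x - regularEnergy S ι f x := by
      rwa [one_div, inv_mul_le_iff₀ hm]
    linarith

/-- Solvability of the variational inequality `A x ∈ ∂Φ(x)` for skew-symmetric `A`. -/
theorem exists_forall_finiteEnergy_le (hn : 1 ≤ n) (hΩb : Bornology.IsBounded Ω) (hp : 2 ≤ p)
    (hm : 1 < m) (S ι : Lp ℝ (ENNReal.ofReal p) (volume.restrict Ω) →L[ℝ] L2 Ω) (f : L2 Ω)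
    (A : LpPair Ω p →L[ℝ] L2 Ω)
    (hA : ∀ x ∈ sobolevPairs Ω p, ∀ y ∈ sobolevPairs Ω p,
      inner ℝ (A x) (ι y.1) = -inner ℝ (A y) (ι x.1)) :
    ∃ x ∈ energyDomain Ω p m, ∀ y ∈ energyDomain Ω p m,
      finiteEnergy S ι f m x + inner ℝ (A x) (ι y.1) ≤ finiteEnergy S ι f m y := by
  have hp0 : 0 < p := by linarith
  have hm0 : 0 < m := by linarith
  obtain ⟨R, hR0, hR⟩ : ∃ R, 0 ≤ R ∧ Ω ⊆ Metric.closedBall 0 R := by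
    obtain ⟨R, hR⟩ := hΩb.subset_closedBall 0
    exact ⟨max R 0, le_max_right _ _, hR.trans (Metric.closedBall_subset_closedBall (le_max_left _ _))⟩
  have hpoin : ∀ x ∈ sobolevPairs Ω p, ‖x.1‖ ≤ p * R * ‖x.2‖ := fun x hx =>
    norm_fst_le_of_mem_sobolevPairs hn hR0 hR (by linarith) hx
  set B : LpPair Ω p →ₗ[ℝ] LpPair Ω p →ₗ[ℝ] ℝ :=
    (innerₗ (L2 Ω)).compl₁₂ A.toLinearMap
      (ι.toLinearMap.comp (LinearMap.fst ℝ _ _)) with hB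
  have hBa : ∀ x y, B x y = inner ℝ (A x) (ι y.1) := fun x y => rfl
  -- `c` bounds the norm of a pair by that of its gradient. `d` is the radius beyond which the
  -- energy exceeds its value zero at the origin.
  set c : ℝ := max (p * R) 1 with hc
  have hc0 : 0 < c := lt_max_of_lt_right one_pos
  set d : ℝ := max (p * (‖ι‖ * (p * R) * ‖f‖)) 1 with hd
  suffices h : ∃ x ∈ energyDomain Ω p m, ∀ y ∈ energyDomain Ω p m,
      finiteEnergy S ι f m x - finiteEnergy S ι f m y + B x y ≤ 0 by
    obtain ⟨x, hx, hxy⟩ := h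
    refine ⟨x, hx, fun y hy => ?_⟩
    have := hxy y hy
    rw [hBa] at this
    linarith
  -- The uniformly convex function is `‖∇u‖ ^ p`. In `κ` the factor two comes from the half
  -- difference in Clarkson's inequality, and `c` from Poincaré's.
  refine exists_forall_sub_add_skew_nonpos (D := energyDomain Ω p m)
    (zero_mem_energyDomain hm0) (N := fun x => ‖x.2‖ ^ p) (κ := ((2 * c) ^ p)⁻¹) (p := p)
    (by positivity) hp0 (fun x => by positivity) ?_
    (convexOn_finiteEnergy (by linarith) hm.le S ι f) B ?_ ?_ (R := d ^ p) ?_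
  · intro x hx y hy
    have h1 := Lp_norm_midpoint_rpow_add_le hp x.2 y.2
    refine le_trans (add_le_add (le_of_eq ?_) ?_) h1
    · rw [midpoint_eq_smul_add, midpoint_eq_smul_add]; rfl
    · have hmem : x - y ∈ sobolevPairs Ω p := sub_mem hx.1 hy.1
      have h2 : ‖x - y‖ ≤ c * ‖x.2 - y.2‖ := by
        rw [Prod.norm_def]
        refine max_le ((hpoin _ hmem).trans ?_) ?_
        · exact mul_le_mul_of_nonneg_right (le_max_left _ _) (norm_nonneg _)
        · exact le_mul_of_one_le_left (norm_nonneg _) (le_max_right _ _)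
      rw [norm_smul, inv_mul_le_iff₀ (by positivity),
        ← Real.mul_rpow (by positivity) (by positivity)]
      refine Real.rpow_le_rpow (norm_nonneg _) (h2.trans (le_of_eq ?_)) hp0.le
      rw [Real.norm_of_nonneg (by norm_num)]
      ring
  · intro x hx y hy
    exact hA x hx.1 y hy.1
  · intro v _
    have hg : Continuous fun u : LpPair Ω p =>
        finiteEnergy S ι f m v - inner ℝ (A u) (ι v.1) := by fun_prop
    refine (congrArg IsClosed (Set.ext fun u => and_congr_right fun _ => ?_)).mpr
      (isClosed_finiteEnergy_le hp0.le hm0 S ι f hg)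
    rw [hBa]
    constructor <;> intro h <;> linarith
  · intro x hx hle
    rw [finiteEnergy_zero hp0 hm0, map_zero, sub_zero, add_zero] at hle
    refine Real.rpow_le_rpow (norm_nonneg _) ?_ hp0.le
    by_contra! hlt
    have ht1 : 1 < ‖x.2‖ := (le_max_right _ _).trans_lt hlt
    have ht2 : p * (‖ι‖ * (p * R) * ‖f‖) < ‖x.2‖ := (le_max_left _ _).trans_lt hlt
    have h1 : -(inner ℝ (ι x.1) f) ≤ ‖ι‖ * (p * R) * ‖f‖ * ‖x.2‖ := by
      refine (neg_le_abs _).trans ((abs_real_inner_le_norm _ _).trans ?_)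
      calc ‖ι x.1‖ * ‖f‖ ≤ ‖ι‖ * (p * R * ‖x.2‖) * ‖f‖ :=
            mul_le_mul_of_nonneg_right (ι.le_opNorm_of_le (hpoin x hx.1)) (norm_nonneg _)
        _ = _ := by ring
    have h2 : (1 / p) * ‖x.2‖ ^ p ≤ -(inner ℝ (ι x.1) f) := by
      have h3 : 0 ≤ (1 / m) * (∫⁻ r in Ω, ‖x.1 r‖ₑ ^ m).toReal := by positivity
      have h4 : 0 ≤ (1 / 2) * ‖S x.1‖ ^ 2 := by positivity
      simp only [finiteEnergy, regularEnergy] at hle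
      linarith
    -- Comparison with zero bounds `‖∇u‖ ^ p` by a multiple of `‖∇u‖`. Since `‖∇u‖ > 1` and `p ≥ 2`,
    -- the square obeys the same bound, which contradicts `‖∇u‖ > d`.
    have h3 : ‖x.2‖ ^ (2 : ℝ) ≤ ‖x.2‖ ^ p := Real.rpow_le_rpow_of_exponent_le ht1.le hp
    rw [Real.rpow_two] at h3
    have h4 : ‖x.2‖ ^ p ≤ p * (‖ι‖ * (p * R) * ‖f‖) * ‖x.2‖ := by
      have h5 := h2.trans h1
      rw [one_div, inv_mul_le_iff₀ hp0] at h5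
      linarith
    nlinarith

end ASD

/-! ### Gateaux derivative of the energy and the Euler–Lagrange equation -/

namespace ASD

variable {n : ℕ} {Ω : Set (Rn n)} {a : Rn n → Rn n} {a₀ f : Rn n → ℝ} {p m : ℝ}

theorem MemLp_top_ae_bound {α : Type*} [MeasurableSpace α] {μ : Measure α} {g : α → ℝ}
    (hg : MemLp g ⊤ μ) : ∃ C : ℝ, ∀ᵐ r ∂μ, ‖g r‖ ≤ C := by
  refine ⟨(eLpNormEssSup g μ).toReal, ?_⟩
  have hfin : eLpNormEssSup g μ ≠ ⊤ := by
    rw [← eLpNorm_exponent_top]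
    exact hg.2.ne
  filter_upwards [enorm_ae_le_eLpNormEssSup g μ] with r hr
  rw [← toReal_enorm]
  exact ENNReal.toReal_mono hfin hr

theorem toReal_lintegral_enorm_rpow {α F : Type*} [MeasurableSpace α] {μ : Measure α}
    [NormedAddCommGroup F] {q : ℝ} (hq : 0 ≤ q) {g : α → F} (hg : AEStronglyMeasurable g μ) :
    (∫⁻ r, ‖g r‖ₑ ^ q ∂μ).toReal = ∫ r, ‖g r‖ ^ q ∂μ := by
  rw [integral_eq_lintegral_of_nonneg_ae (Eventually.of_forall fun r => by positivity)
    (hg.norm.aemeasurable.pow_const q).aestronglyMeasurable]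
  simp only [← ofReal_norm, ENNReal.ofReal_rpow_of_nonneg (norm_nonneg _) hq]

theorem Lp_coeFn_add_smul {α G : Type*} [MeasurableSpace α] {μ : Measure α}
    [NormedAddCommGroup G] [NormedSpace ℝ G] {P : ℝ≥0∞} (g h : Lp G P μ) (t : ℝ) :
    (g + t • h : Lp G P μ) =ᵐ[μ] fun r => g r + t • h r := by
  filter_upwards [Lp.coeFn_add g (t • h), Lp.coeFn_smul t h] with r h1 h2
  rw [h1, Pi.add_apply, h2, Pi.smul_apply]

theorem memLp_iff_lintegral_ne_top {α G : Type*} [MeasurableSpace α] {μ : Measure α}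
    [NormedAddCommGroup G] {q : ℝ} (hq : 0 < q) {g : α → G} (hg : AEStronglyMeasurable g μ) :
    MemLp g (ENNReal.ofReal q) μ ↔ ∫⁻ r, ‖g r‖ₑ ^ q ∂μ ≠ ⊤ := by
  rw [MemLp, and_iff_right hg,
    eLpNorm_lt_top_iff_lintegral_rpow_enorm_lt_top (by simpa using hq) ENNReal.ofReal_ne_top,
    ENNReal.toReal_ofReal hq.le, lt_top_iff_ne_top]

theorem lintegral_fst_add_smul (x y : LpPair Ω p) (t : ℝ) :
    ∫⁻ r in Ω, ‖(x + t • y).1 r‖ₑ ^ m = ∫⁻ r in Ω, ‖x.1 r + t • y.1 r‖ₑ ^ m := by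
  refine lintegral_congr_ae ?_
  filter_upwards [Lp_coeFn_add_smul x.1 y.1 t] with r hr
  change ‖(x.1 + t • y.1) r‖ₑ ^ m = _
  rw [hr]

theorem norm_snd_add_smul_rpow (hp : 0 < p) (x y : LpPair Ω p) (t : ℝ) :
    ‖(x + t • y).2‖ ^ p = ∫ r in Ω, ‖x.2 r + t • y.2 r‖ ^ p := by
  rw [Lp_norm_rpow_eq_integral hp]
  refine integral_congr_ae ?_
  filter_upwards [Lp_coeFn_add_smul x.2 y.2 t] with r hr
  change ‖(x.2 + t • y.2) r‖ ^ p = _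
  rw [hr]

section Line

variable [Fact (1 ≤ ENNReal.ofReal p)]
  {S ι : Lp ℝ (ENNReal.ofReal p) (volume.restrict Ω) →L[ℝ] L2 Ω} {F : L2 Ω} {x y : LpPair Ω p}

/-- Minkowski's inequality in `Lᵐ`: along such directions the whole line stays in the domain, so the
derivative at an interior minimum vanishes. -/
theorem add_smul_mem_energyDomain (hm : 0 < m) (hx : x ∈ energyDomain Ω p m)
    (hy : y ∈ sobolevPairs Ω p) (hym : MemLp y.1 (ENNReal.ofReal m) (volume.restrict Ω))
    (t : ℝ) : x + t • y ∈ energyDomain Ω p m := by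
  have hxm := (memLp_iff_lintegral_ne_top hm (Lp.aestronglyMeasurable x.1)).2 hx.2
  have hxy := hxm.add (hym.const_smul t)
  refine ⟨add_mem hx.1 (Submodule.smul_mem _ _ hy), ?_⟩
  rw [lintegral_fst_add_smul]
  exact (memLp_iff_lintegral_ne_top hm hxy.1).1 hxy

theorem finiteEnergy_add_smul (hp : 0 < p) (hm : 0 < m) (x y : LpPair Ω p) (t : ℝ) :
    finiteEnergy S ι F m (x + t • y) =
      (1 / p) * (∫ r in Ω, ‖x.2 r + t • y.2 r‖ ^ p) + (1 / 2) * ‖S x.1 + t • S y.1‖ ^ 2 +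
        (inner ℝ (ι x.1) F + t * inner ℝ (ι y.1) F) +
        (1 / m) * (∫ r in Ω, ‖x.1 r + t • y.1 r‖ ^ m) := by
  have e2 : S (x + t • y).1 = S x.1 + t • S y.1 := (S.map_add _ _).trans (by rw [← S.map_smul]; rfl)
  have e3 : ι (x + t • y).1 = ι x.1 + t • ι y.1 := (ι.map_add _ _).trans (by rw [← ι.map_smul]; rfl)
  rw [finiteEnergy, regularEnergy, norm_snd_add_smul_rpow hp, e2, e3, lintegral_fst_add_smul,
    toReal_lintegral_enorm_rpow hm.le (show AEStronglyMeasurable (fun r => x.1 r + t • y.1 r) _ from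
      (Lp.aestronglyMeasurable x.1).add ((Lp.aestronglyMeasurable y.1).const_smul t)),
    inner_add_left, real_inner_smul_left]

theorem hasDerivAt_norm_add_smul_sq {H : Type*} [NormedAddCommGroup H] [InnerProductSpace ℝ H]
    (u v : H) : HasDerivAt (fun t : ℝ => ‖u + t • v‖ ^ 2) (2 * inner ℝ u v) 0 := by
  have h1 : HasDerivAt (fun t : ℝ => u + t • v) v 0 := by
    simpa using ((hasDerivAt_id (0 : ℝ)).smul_const v).const_add u
  simpa using h1.norm_sq

/-- The Gateaux derivative of the energy. -/
theorem hasDerivAt_finiteEnergy_add_smul (hp : 1 < p) (hm : 1 < m)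
    (hx : x ∈ energyDomain Ω p m) (hym : MemLp y.1 (ENNReal.ofReal m) (volume.restrict Ω)) :
    HasDerivAt (fun t : ℝ => finiteEnergy S ι F m (x + t • y))
      ((∫ r in Ω, ‖x.2 r‖ ^ (p - 2) * inner ℝ (x.2 r) (y.2 r)) +
        inner ℝ (S x.1) (S y.1) + inner ℝ (ι y.1) F +
        (∫ r in Ω, ‖x.1 r‖ ^ (m - 2) * inner ℝ (x.1 r) (y.1 r))) 0 := by
  have hp0 : 0 < p := by linarith
  have hm0 : 0 < m := by linarith
  have hxm := (memLp_iff_lintegral_ne_top hm0 (Lp.aestronglyMeasurable x.1)).2 hx.2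
  have hd1 := (hasDerivAt_integral_norm_add_smul_rpow hp (Lp.memLp x.2) (Lp.memLp y.2)).2
  have hd2 := (hasDerivAt_integral_norm_add_smul_rpow hm hxm hym).2
  have hd4 : ∀ c d : ℝ, HasDerivAt (fun t : ℝ => c + t * d) d 0 := fun c d => by
    simpa using ((hasDerivAt_id (0 : ℝ)).mul_const d).const_add c
  have hderiv := (((hd1.const_mul (1 / p)).fun_add
    ((hasDerivAt_norm_add_smul_sq (S x.1) (S y.1)).const_mul (1 / 2))).fun_add
    (hd4 (inner ℝ (ι x.1) F) (inner ℝ (ι y.1) F))).fun_add (hd2.const_mul (1 / m))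
  simp only [finiteEnergy_add_smul hp0 hm0]
  refine hderiv.congr_deriv ?_
  rw [← integral_const_mul, ← integral_const_mul]
  have i1 : ∀ r, 1 / p * (p * ‖x.2 r‖ ^ (p - 2) * inner ℝ (x.2 r) (y.2 r)) =
      ‖x.2 r‖ ^ (p - 2) * inner ℝ (x.2 r) (y.2 r) := fun r => by
    rw [one_div, mul_assoc, inv_mul_cancel_left₀ hp0.ne']
  have i2 : ∀ r, 1 / m * (m * ‖x.1 r‖ ^ (m - 2) * inner ℝ (x.1 r) (y.1 r)) =
      ‖x.1 r‖ ^ (m - 2) * inner ℝ (x.1 r) (y.1 r) := fun r => by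
    rw [one_div, mul_assoc, inv_mul_cancel_left₀ hm0.ne']
  simp only [i1, i2]
  ring

/-- The Euler–Lagrange equation of the variational inequality in the direction of `y`. -/
theorem euler_lagrange_of_forall_le (hp : 1 < p) (hm : 1 < m) {q : L2 Ω}
    (hx : x ∈ energyDomain Ω p m) (hq : inner ℝ q (ι x.1) = 0)
    (hmin : ∀ z ∈ energyDomain Ω p m,
      finiteEnergy S ι F m x + inner ℝ q (ι z.1) ≤ finiteEnergy S ι F m z)
    (hy : y ∈ sobolevPairs Ω p) (hym : MemLp y.1 (ENNReal.ofReal m) (volume.restrict Ω)) :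
    (∫ r in Ω, ‖x.2 r‖ ^ (p - 2) * inner ℝ (x.2 r) (y.2 r)) +
      inner ℝ (S x.1) (S y.1) + inner ℝ (ι y.1) F +
      (∫ r in Ω, ‖x.1 r‖ ^ (m - 2) * inner ℝ (x.1 r) (y.1 r)) = inner ℝ q (ι y.1) := by
  have hm0 : 0 < m := by linarith
  have hlin : HasDerivAt (fun t : ℝ => t * inner ℝ q (ι y.1)) (inner ℝ q (ι y.1)) 0 := by
    simpa using (hasDerivAt_id (0 : ℝ)).mul_const (inner ℝ q (ι y.1))
  have hderiv := (hasDerivAt_finiteEnergy_add_smul (S := S) (ι := ι) (F := F) hp hm hx hym).fun_sub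
    hlin
  -- As `q` is orthogonal to `x`, the pairing of `q` with `x + t y` is linear in `t`, and `t = 0` is
  -- a global minimum.
  have hlocal : IsLocalMin
      (fun t : ℝ => finiteEnergy S ι F m (x + t • y) - t * inner ℝ q (ι y.1)) 0 :=
    Eventually.of_forall fun t => by
      have h1 := hmin _ (add_smul_mem_energyDomain hm0 hx hy hym t)
      have e3 : ι (x + t • y).1 = ι x.1 + t • ι y.1 :=
        (ι.map_add _ _).trans (by rw [← ι.map_smul]; rfl)
      rw [e3, inner_add_right, real_inner_smul_right, hq] at h1
      simp only [zero_smul, add_zero, zero_mul, sub_zero]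
      linarith
  exact sub_eq_zero.1 (hlocal.hasDerivAt_eq_zero hderiv)

end Line

/-! ### The extended-valued energy, its conjugate and Fenchel–Young duality -/

section

variable [Fact (1 ≤ ENNReal.ofReal p)] [IsFiniteMeasure (volume.restrict Ω)]

/-- With the square root the quadratic term becomes `(1/2) ‖S u‖²`, so its convexity, continuity and
derivative are those of a squared norm. -/
theorem exists_clm_sqrt_mul (hΩ : IsOpen Ω) (hΩb : Bornology.IsBounded Ω)
    (ha : ContDiffOn ℝ ∞ a (closure Ω)) (hp : 2 ≤ ENNReal.ofReal p)
    (ha₀ : MemLp a₀ ⊤ (volume.restrict Ω)) :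
    ∃ S : Lp ℝ (ENNReal.ofReal p) (volume.restrict Ω) →L[ℝ] L2 Ω, ∀ x,
      S x =ᵐ[volume.restrict Ω] fun r => √((1 / 2) * (divergence a r + a₀ r)) * x r := by
  obtain ⟨C₁, hC₁⟩ := exists_forall_norm_divergence_le hΩ hΩb ha
  obtain ⟨C₂, hC₂⟩ := MemLp_top_ae_bound ha₀
  refine exists_clm_Lp_bilin (μ := volume.restrict Ω) hp (ContinuousLinearMap.mul ℝ ℝ)
    (g := fun r => √((1 / 2) * (divergence a r + a₀ r))) ?_ (C := √((1 / 2) * (C₁ + C₂))) ?_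
  · exact Real.continuous_sqrt.comp_aestronglyMeasurable
      ((((continuousOn_divergence hΩ ha).aestronglyMeasurable hΩ.measurableSet).add ha₀.1).const_mul
        (1 / 2))
  · filter_upwards [ae_restrict_of_forall_mem hΩ.measurableSet hC₁, hC₂] with r h1 h2
    rw [Real.norm_of_nonneg (Real.sqrt_nonneg _)]
    refine Real.sqrt_le_sqrt ?_
    have h3 := (le_abs_self _).trans h1
    have h4 := (le_abs_self _).trans h2
    linarith

theorem exists_clm_inclusion (hp : 2 ≤ ENNReal.ofReal p) :
    ∃ ι : Lp ℝ (ENNReal.ofReal p) (volume.restrict Ω) →L[ℝ] L2 Ω, ∀ x,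
      ι x =ᵐ[volume.restrict Ω] x :=
  exists_clm_Lp (b := fun _ => ContinuousLinearMap.id ℝ ℝ) hp aestronglyMeasurable_const
    (C := ‖ContinuousLinearMap.id ℝ ℝ‖) (Eventually.of_forall fun _ => le_rfl)

/-- The continuous operators and the vector that represent the energy. -/
structure IsEnergyData (a : Rn n → Rn n) (a₀ f : Rn n → ℝ)
    (S ι : Lp ℝ (ENNReal.ofReal p) (volume.restrict Ω) →L[ℝ] L2 Ω) (F : L2 Ω) : Prop where
  inclusion : ∀ x, ι x =ᵐ[volume.restrict Ω] x
  sqrt_mul : ∀ x, S x =ᵐ[volume.restrict Ω] fun r => √((1 / 2) * (divergence a r + a₀ r)) * x r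
  nonneg : ∀ᵐ x ∂(volume.restrict Ω), 0 ≤ (1 / 2) * (divergence a x + a₀ x)
  linear : F =ᵐ[volume.restrict Ω] f

variable {S ι : Lp ℝ (ENNReal.ofReal p) (volume.restrict Ω) →L[ℝ] L2 Ω} {F : L2 Ω}

theorem inclusion_mem_W1p0 (hι : ∀ x, ι x =ᵐ[volume.restrict Ω] x)
    (hΩ : IsOpen Ω) {x : LpPair Ω p} (hx : x ∈ sobolevPairs Ω p) :
    ι x.1 ∈ W1p0 Ω p :=
  (memW1p0_iff hΩ).2 ⟨x, hx, (hι x.1).symm⟩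

theorem exists_of_mem_W1p0 (hι : ∀ x, ι x =ᵐ[volume.restrict Ω] x)
    (hΩ : IsOpen Ω) {u : L2 Ω} (hu : u ∈ W1p0 Ω p) :
    ∃ x ∈ sobolevPairs Ω p, ι x.1 = u := by
  obtain ⟨x, hx, hxu⟩ := (memW1p0_iff hΩ).1 hu
  exact ⟨x, hx, Lp.ext ((hι x.1).trans hxu)⟩

theorem energy_inclusion (hd : IsEnergyData a a₀ f S ι F) (hΩ : IsOpen Ω) (hp : 0 < p) {x : LpPair Ω p}
    (hx : x ∈ sobolevPairs Ω p) :
    energy Ω p m a a₀ f (ι x.1) = (regularEnergy S ι F x : EReal) +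
      ((ENNReal.ofReal (1 / m) * ∫⁻ r in Ω, ‖x.1 r‖ₑ ^ m : ℝ≥0∞) : EReal) := by
  have h1 : ∫ r in Ω, ‖weakGradient Ω (ι x.1) r‖ ^ p = ‖x.2‖ ^ p := by
    rw [Lp_norm_rpow_eq_integral hp]
    refine integral_congr_ae ?_
    filter_upwards [weakGradient_ae_eq_snd hΩ hx (hd.inclusion x.1).symm] with r hr
    rw [hr]
  have h2 : (1 / 4) * ∫ r in Ω, (divergence a r + a₀ r) * |ι x.1 r| ^ 2 =
      (1 / 2) * ‖S x.1‖ ^ 2 := by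
    rw [← real_inner_self_eq_norm_sq, L2.inner_def, ← integral_const_mul, ← integral_const_mul]
    refine integral_congr_ae ?_
    filter_upwards [hd.sqrt_mul x.1, hd.inclusion x.1, hd.nonneg] with r e1 e2 e3
    simp only [e1, e2, sq_abs, real_inner_self_eq_norm_sq, Real.norm_eq_abs, mul_pow,
      Real.sq_sqrt e3]
    ring
  have h3 : ∫ r in Ω, ι x.1 r * f r = inner ℝ (ι x.1) F := by
    rw [L2.inner_def]
    refine integral_congr_ae ?_
    filter_upwards [hd.linear] with r e1
    rw [e1]
    simp [mul_comm]
  have h4 : ∫⁻ r in Ω, ‖ι x.1 r‖ₑ ^ m = ∫⁻ r in Ω, ‖x.1 r‖ₑ ^ m := by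
    refine lintegral_congr_ae ?_
    filter_upwards [hd.inclusion x.1] with r e1
    rw [e1]
  rw [energy, if_pos (inclusion_mem_W1p0 hd.inclusion hΩ hx), h1, h2, h3, h4, regularEnergy]

theorem energy_inclusion_of_mem (hd : IsEnergyData a a₀ f S ι F)
    (hΩ : IsOpen Ω) (hp : 0 < p) (hm : 0 < m) {x : LpPair Ω p}
    (hx : x ∈ energyDomain Ω p m) :
    energy Ω p m a a₀ f (ι x.1) = (finiteEnergy S ι F m x : EReal) := by
  rw [energy_inclusion hd hΩ hp hx.1, finiteEnergy, EReal.coe_add]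
  congr 1
  rw [← ENNReal.ofReal_toReal hx.2, ← ENNReal.ofReal_mul (by positivity),
    ENNReal.toReal_ofReal (by positivity), EReal.coe_ennreal_ofReal,
    max_eq_left (by positivity)]

theorem energy_inclusion_of_notMem (hd : IsEnergyData a a₀ f S ι F)
    (hΩ : IsOpen Ω) (hp : 0 < p) (hm : 0 < m) {x : LpPair Ω p}
    (hx : x ∈ sobolevPairs Ω p) (hx' : x ∉ energyDomain Ω p m) :
    energy Ω p m a a₀ f (ι x.1) = ⊤ := by
  have h : ∫⁻ r in Ω, ‖x.1 r‖ₑ ^ m = ⊤ := by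
    by_contra h
    exact hx' ⟨hx, h⟩
  rw [energy_inclusion hd hΩ hp hx, h, ENNReal.mul_top (by simpa using hm)]
  simp

/-- Points of infinite energy contribute `-∞` to the supremum, so only the effective domain matters.
-/
theorem conjugate_energy_le_iff (hd : IsEnergyData a a₀ f S ι F)
    (hΩ : IsOpen Ω) (hp : 0 < p) (hm : 0 < m) (q : L2 Ω) (c : ℝ) :
    conjugate (energy Ω p m a a₀ f) q ≤ c ↔ ∀ y ∈ energyDomain Ω p m,
      inner ℝ q (ι y.1) - finiteEnergy S ι F m y ≤ c := by
  rw [conjugate, iSup_le_iff]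
  constructor
  · intro h y hy
    have := h (ι y.1)
    rw [energy_inclusion_of_mem hd hΩ hp hm hy, real_inner_comm] at this
    exact_mod_cast this
  · intro h v
    by_cases hv : v ∈ W1p0 Ω p
    · obtain ⟨y, hy, rfl⟩ := exists_of_mem_W1p0 hd.inclusion hΩ hv
      by_cases hy' : y ∈ energyDomain Ω p m
      · rw [energy_inclusion_of_mem hd hΩ hp hm hy', real_inner_comm]
        exact_mod_cast h y hy'
      · rw [energy_inclusion_of_notMem hd hΩ hp hm hy hy', EReal.sub_top]
        exact bot_le
    · rw [energy, if_neg hv, EReal.sub_top]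
      exact bot_le

theorem le_conjugate_energy (hd : IsEnergyData a a₀ f S ι F)
    (hΩ : IsOpen Ω) (hp : 0 < p) (hm : 0 < m) (q : L2 Ω)
    {y : LpPair Ω p} (hy : y ∈ energyDomain Ω p m) :
    ((inner ℝ q (ι y.1) - finiteEnergy S ι F m y : ℝ) : EReal) ≤
      conjugate (energy Ω p m a a₀ f) q := by
  refine le_trans (le_of_eq ?_) (le_iSup _ (ι y.1))
  rw [energy_inclusion_of_mem hd hΩ hp hm hy, real_inner_comm]
  rfl

/-- The Fenchel–Young inequality at `v = x`, where the pairing vanishes. -/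
theorem zero_le_energy_add_conjugate (hd : IsEnergyData a a₀ f S ι F)
    (hΩ : IsOpen Ω) (hp : 0 < p) (hm : 0 < m) {q : L2 Ω}
    {x : LpPair Ω p} (hx : x ∈ sobolevPairs Ω p) (hq : inner ℝ q (ι x.1) = 0) :
    0 ≤ energy Ω p m a a₀ f (ι x.1) + conjugate (energy Ω p m a a₀ f) q := by
  by_cases hx' : x ∈ energyDomain Ω p m
  · have h := le_conjugate_energy hd hΩ hp hm q hx'
    rw [energy_inclusion_of_mem hd hΩ hp hm hx']
    refine le_trans (le_of_eq ?_) (add_le_add_right h _)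
    rw [hq, ← EReal.coe_add]
    simp
  -- In `EReal` the sum `⊤ + ⊥` is `⊥`, so the conjugate must be shown to differ from `⊥`; testing
  -- it with zero does this.
  · have h := le_conjugate_energy hd hΩ hp hm q (zero_mem_energyDomain hm)
    rw [finiteEnergy_zero hp hm] at h
    rw [energy_inclusion_of_notMem hd hΩ hp hm hx hx', EReal.top_add_of_ne_bot]
    · exact le_top
    · exact ((EReal.bot_lt_coe _).trans_le h).ne'

/-- The right side says that `q` is a subgradient at `x` when `⟨q, x⟩ = 0`: it is the equality case
of Fenchel–Young. -/
theorem energy_add_conjugate_nonpos_iff (hd : IsEnergyData a a₀ f S ι F)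
    (hΩ : IsOpen Ω) (hp : 0 < p) (hm : 0 < m) {q : L2 Ω}
    {x : LpPair Ω p} (hx : x ∈ sobolevPairs Ω p) :
    energy Ω p m a a₀ f (ι x.1) + conjugate (energy Ω p m a a₀ f) q ≤ 0 ↔
      x ∈ energyDomain Ω p m ∧ ∀ y ∈ energyDomain Ω p m,
        finiteEnergy S ι F m x + inner ℝ q (ι y.1) ≤
          finiteEnergy S ι F m y := by
  by_cases hx' : x ∈ energyDomain Ω p m
  · rw [energy_inclusion_of_mem hd hΩ hp hm hx', and_iff_right hx']
    have h : ((finiteEnergy S ι F m x : ℝ) : EReal) +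
        conjugate (energy Ω p m a a₀ f) q ≤ 0 ↔
        conjugate (energy Ω p m a a₀ f) q ≤ ((-finiteEnergy S ι F m x : ℝ) : EReal) := by
      induction conjugate (energy Ω p m a a₀ f) q with
      | bot => simp
      | top => simp
      | coe c =>
        rw [← EReal.coe_add, ← EReal.coe_zero, EReal.coe_le_coe_iff, EReal.coe_le_coe_iff]
        constructor <;> intro h <;> linarith
    rw [h, conjugate_energy_le_iff hd hΩ hp hm]
    refine forall₂_congr fun y _ => ?_
    constructor <;> intro h <;> linarith
  · have h := le_conjugate_energy hd hΩ hp hm q (zero_mem_energyDomain hm)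
    rw [finiteEnergy_zero hp hm] at h
    rw [energy_inclusion_of_notMem hd hΩ hp hm hx hx', EReal.top_add_of_ne_bot]
    · simp [hx']
    · exact ((EReal.bot_lt_coe _).trans_le h).ne'

end

end ASD

/-! ### From the variational inequality to the weak equation -/

namespace ASD

/-- The norm is `‖g‖ ^ (q - 1) ≤ 1 + ‖g‖ ^ q`, and the measure is finite. -/
theorem integrable_norm_rpow_smul {α G : Type*} [MeasurableSpace α] {μ : Measure α}
    [IsFiniteMeasure μ] [NormedAddCommGroup G] [NormedSpace ℝ G] {q : ℝ} (hq : 1 < q) {g : α → G}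
    (hg : MemLp g (ENNReal.ofReal q) μ) : Integrable (fun r => ‖g r‖ ^ (q - 2) • g r) μ := by
  refine ((integrable_const (1 : ℝ)).add
    (integrable_norm_rpow_of_memLp (by linarith) hg)).mono' ?_ (Eventually.of_forall fun r => ?_)
  · exact (hg.1.norm.aemeasurable.pow_const (q - 2)).aestronglyMeasurable.smul hg.1
  · rw [norm_smul, Real.norm_of_nonneg (by positivity),
      ← Real.rpow_add_one' (norm_nonneg _) (by linarith)]
    change _ ≤ 1 + ‖g r‖ ^ q
    rcases le_total ‖g r‖ 1 with h | h
    · have h1 : ‖g r‖ ^ (q - 2 + 1) ≤ 1 := Real.rpow_le_one (norm_nonneg _) h (by linarith)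
      have h2 : 0 ≤ ‖g r‖ ^ q := by positivity
      linarith
    · have h1 : ‖g r‖ ^ (q - 2 + 1) ≤ ‖g r‖ ^ q :=
        Real.rpow_le_rpow_of_exponent_le h (by linarith)
      linarith

variable {n : ℕ} {Ω : Set (Rn n)} {a : Rn n → Rn n} {a₀ f : Rn n → ℝ} {p m : ℝ}
  [Fact (1 ≤ ENNReal.ofReal p)] [IsFiniteMeasure (volume.restrict Ω)]
  {S ι : Lp ℝ (ENNReal.ofReal p) (volume.restrict Ω) →L[ℝ] L2 Ω} {F : L2 Ω}

/-- The Euler–Lagrange equation in the direction `(ψ, ∇ψ)`. The integral of `(1/2) (div a) u ψ`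
arises once from `S` and once from `A`, and the two cancel. -/
theorem isWeakSolution_of_forall_le (hΩ : IsOpen Ω) (hΩb : Bornology.IsBounded Ω)
    (ha : ContDiffOn ℝ ∞ a (closure Ω)) (ha₀ : MemLp a₀ ⊤ (volume.restrict Ω)) (hp : 2 ≤ p)
    (hm : 1 < m) (hd : IsEnergyData a a₀ f S ι F) {A : LpPair Ω p →L[ℝ] L2 Ω}
    (hA : ∀ x, A x =ᵐ[volume.restrict Ω] fun r =>
      inner ℝ (a r) (x.2 r) + (1 / 2) * divergence a r * x.1 r)
    {x : LpPair Ω p} (hx : x ∈ energyDomain Ω p m) (hq : inner ℝ (A x) (ι x.1) = 0)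
    (hmin : ∀ z ∈ energyDomain Ω p m,
      finiteEnergy S ι F m x + inner ℝ (A x) (ι z.1) ≤ finiteEnergy S ι F m z) :
    IsWeakSolution Ω p m a a₀ f (ι x.1) := by
  have hm0 : 0 < m := by linarith
  have hw := weakGradient_ae_eq_snd hΩ hx.1 (hd.inclusion x.1).symm
  have hu := hd.inclusion x.1
  have hxm := (memLp_iff_lintegral_ne_top hm0 (Lp.aestronglyMeasurable x.1)).2 hx.2
  refine ⟨inclusion_mem_W1p0 hd.inclusion hΩ hx.1, ?_, ?_, fun ψ hψ => ?_⟩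
  · refine IntegrableOn.locallyIntegrableOn (μ := volume) ?_
    refine (integrable_norm_rpow_smul (by linarith) (Lp.memLp x.2)).congr ?_
    filter_upwards [hw] with r hr
    rw [hr]
  · refine IntegrableOn.locallyIntegrableOn (μ := volume) ?_
    refine (integrable_norm_rpow_smul hm hxm).congr ?_
    filter_upwards [hu] with r hr
    rw [hr, smul_eq_mul, mul_comm, Real.norm_eq_abs]
  obtain ⟨C₁, hC₁⟩ := exists_forall_norm_divergence_le hΩ hΩb ha
  obtain ⟨C₂, hC₂⟩ := MemLp_top_ae_bound ha₀
  obtain ⟨C₃, hC₃⟩ := hψ.exists_bound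
  obtain ⟨y, ⟨hyψ, hy1, hy2⟩⟩ : ∃ y : LpPair Ω p, y ∈ testPairs Ω p ∧
      y.1 =ᵐ[volume.restrict Ω] ψ ∧ y.2 =ᵐ[volume.restrict Ω] gradient ψ :=
    ⟨_, hψ.toLp_mem_testPairs, (hψ.memLp _ _).coeFn_toLp, (hψ.memLp_gradient _ _).coeFn_toLp⟩
  have hEL := euler_lagrange_of_forall_le (by linarith) hm hx hq hmin
    (testPairs_le_sobolevPairs hyψ) ((hψ.memLp _ _).ae_eq hy1.symm)
  have hxψ : Integrable (fun r => x.1 r * ψ r) (volume.restrict Ω) :=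
    (Lp_integrable x.1).mul_bdd hψ.continuous.aestronglyMeasurable (Eventually.of_forall hC₃)
  have hI₁ : Integrable (fun r => (1 / 2) * divergence a r * x.1 r * ψ r) (volume.restrict Ω) := by
    refine ((hxψ.bdd_mul ((continuousOn_divergence hΩ ha).aestronglyMeasurable hΩ.measurableSet)
      (ae_restrict_of_forall_mem hΩ.measurableSet hC₁)).const_mul (1 / 2)).congr
      (Eventually.of_forall fun r => ?_)
    simp only; ring
  have hI₂ : Integrable (fun r => (1 / 2) * a₀ r * x.1 r * ψ r) (volume.restrict Ω) := by
    refine ((hxψ.bdd_mul ha₀.1 hC₂).const_mul (1 / 2)).congr (Eventually.of_forall fun r => ?_)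
    simp only; ring
  -- Integrability of the first-order term is read off from `A x ∈ L²` by subtracting the zero-order
  -- term.
  have hI₃ : Integrable (fun r => inner ℝ (a r) (x.2 r) * ψ r) (volume.restrict Ω) := by
    have h1 : Integrable (A x) (volume.restrict Ω) := (Lp.memLp (A x)).integrable one_le_two
    refine ((h1.mul_bdd hψ.continuous.aestronglyMeasurable
      (Eventually.of_forall hC₃)).sub hI₁).congr ?_
    filter_upwards [hA x] with r hr
    rw [Pi.sub_apply, hr]; ring
  have e1 : ∫ r in Ω, ‖x.2 r‖ ^ (p - 2) * inner ℝ (x.2 r) (y.2 r) =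
      ∫ r in Ω, ‖weakGradient Ω (ι x.1) r‖ ^ (p - 2) *
        inner ℝ (weakGradient Ω (ι x.1) r) (gradient ψ r) := by
    refine integral_congr_ae ?_
    filter_upwards [hw, hy2] with r h1 h2
    rw [h1, h2]
  have e2 : inner ℝ (S x.1) (S y.1) = (∫ r in Ω, (1 / 2) * divergence a r * x.1 r * ψ r) +
      ∫ r in Ω, (1 / 2) * a₀ r * ι x.1 r * ψ r := by
    have h0 : ∫ r in Ω, (1 / 2) * a₀ r * ι x.1 r * ψ r =
        ∫ r in Ω, (1 / 2) * a₀ r * x.1 r * ψ r := by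
      refine integral_congr_ae ?_
      filter_upwards [hu] with r h1
      rw [h1]
    rw [h0, ← integral_add hI₁ hI₂, L2.inner_def]
    refine integral_congr_ae ?_
    filter_upwards [hd.sqrt_mul x.1, hd.sqrt_mul y.1, hd.nonneg, hy1] with r h1 h2 h3 h4
    rw [h1, h2, h4]
    have h5 := Real.mul_self_sqrt h3
    simp only [RCLike.inner_apply, conj_trivial]
    linear_combination x.1 r * ψ r * h5
  have e3 : inner ℝ (ι y.1) F = ∫ r in Ω, f r * ψ r := by
    rw [L2.inner_def]
    refine integral_congr_ae ?_
    filter_upwards [hd.inclusion y.1, hd.linear, hy1] with r h1 h2 h3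
    rw [h1, h2, h3]
    simp
  have e4 : ∫ r in Ω, ‖x.1 r‖ ^ (m - 2) * inner ℝ (x.1 r) (y.1 r) =
      ∫ r in Ω, ι x.1 r * |ι x.1 r| ^ (m - 2) * ψ r := by
    refine integral_congr_ae ?_
    filter_upwards [hu, hy1] with r h1 h2
    rw [h1, h2, Real.norm_eq_abs]
    simp only [RCLike.inner_apply, conj_trivial]
    ring
  have e5 : inner ℝ (A x) (ι y.1) =
      (∫ r in Ω, inner ℝ (a r) (weakGradient Ω (ι x.1) r) * ψ r) +
        ∫ r in Ω, (1 / 2) * divergence a r * x.1 r * ψ r := by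
    have h0 : ∫ r in Ω, inner ℝ (a r) (weakGradient Ω (ι x.1) r) * ψ r =
        ∫ r in Ω, inner ℝ (a r) (x.2 r) * ψ r := by
      refine integral_congr_ae ?_
      filter_upwards [hw] with r h1
      rw [h1]
    rw [h0, ← integral_add hI₃ hI₁, L2.inner_def]
    refine integral_congr_ae ?_
    filter_upwards [hA x, hd.inclusion y.1, hy1] with r h1 h2 h3
    rw [h1, h2, h3]
    simp only [RCLike.inner_apply, conj_trivial]
    ring
  rw [e1, e2, e3, e4, e5] at hEL
  linarith

end ASD

/-! ### The main theorem -/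

theorem theorem3p3 (n : ℕ) (hn : 1 ≤ n) (Ω : Set (ASD.Rn n)) (hΩo : IsOpen Ω)
    (hΩb : Bornology.IsBounded Ω) (p m : ℝ) (hp : 2 ≤ p) (hm : 1 < m)
    (a : ASD.Rn n → ASD.Rn n) (ha : ContDiffOn ℝ ∞ a (closure Ω))
    (a₀ : ASD.Rn n → ℝ) (ha₀ : MemLp a₀ ∞ (volume.restrict Ω))
    (hcoer : ∀ᵐ x ∂(volume.restrict Ω), 0 ≤ (1 / 2) * (ASD.divergence a x + a₀ x))
    (f : ASD.Rn n → ℝ) (hf : MemLp f 2 (volume.restrict Ω)) :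
    -- `I` is well defined on `W₀^{1,p}(Ω)`
    ASD.W1p0 Ω p ⊆ ASD.transportDomain Ω a ∧
    -- the infimum of `I` over `W₀^{1,p}(Ω)` is zero and is attained
    sInf (ASD.functional Ω p m a a₀ f '' ASD.W1p0 Ω p) = 0 ∧
    (∃ u ∈ ASD.W1p0 Ω p, ASD.functional Ω p m a a₀ f u =
      sInf (ASD.functional Ω p m a a₀ f '' ASD.W1p0 Ω p)) ∧
    -- every minimizer solves the boundary value problem
    (∀ u ∈ ASD.W1p0 Ω p, ASD.functional Ω p m a a₀ f u =
        sInf (ASD.functional Ω p m a a₀ f '' ASD.W1p0 Ω p) →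
      ASD.IsWeakSolution Ω p m a a₀ f u) := by
  have hp0 : 0 < p := by linarith
  have hm0 : 0 < m := by linarith
  have : Fact (1 ≤ ENNReal.ofReal p) := ⟨by simpa using (by linarith : 1 ≤ p)⟩
  have : IsFiniteMeasure (volume.restrict Ω) := ⟨by simpa using hΩb.measure_lt_top⟩
  have hp2 : 2 ≤ ENNReal.ofReal p := by
    simpa using ENNReal.ofReal_le_ofReal hp
  obtain ⟨S, hS⟩ := ASD.exists_clm_sqrt_mul hΩo hΩb ha hp2 ha₀
  obtain ⟨ι, hι⟩ := ASD.exists_clm_inclusion (Ω := Ω) hp2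
  obtain ⟨A, hA⟩ := ASD.exists_clm_transport hΩo hΩb ha hp2
  have hd : ASD.IsEnergyData a a₀ f S ι (hf.toLp f) := ⟨hι, hS, hcoer, hf.coeFn_toLp⟩
  have hskew : ∀ x ∈ ASD.sobolevPairs Ω p, ∀ y ∈ ASD.sobolevPairs Ω p,
      inner ℝ (A x) (ι y.1) = -inner ℝ (A y) (ι x.1) := fun x hx y hy =>
    ASD.inner_transport_skew hΩo hΩb ha hA hι hx hy
  have hself : ∀ x ∈ ASD.sobolevPairs Ω p, inner ℝ (A x) (ι x.1) = 0 := fun x hx => by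
    have := hskew x hx x hx
    linarith
  have hT : ∀ x ∈ ASD.sobolevPairs Ω p, ASD.IsTransport Ω a (ι x.1) (A x) := fun x hx =>
    ASD.isTransport_of_mem_sobolevPairs hΩo hΩb ha hx (hι x.1).symm (hA x)
  have hI : ∀ x ∈ ASD.sobolevPairs Ω p, ASD.functional Ω p m a a₀ f (ι x.1) =
      ASD.energy Ω p m a a₀ f (ι x.1) + ASD.conjugate (ASD.energy Ω p m a a₀ f) (A x) :=
    fun x hx => by rw [ASD.functional, (hT x hx).transport_eq hΩo]
  have hnonneg : ∀ u ∈ ASD.W1p0 Ω p, 0 ≤ ASD.functional Ω p m a a₀ f u := fun u hu => by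
    obtain ⟨x, hx, rfl⟩ := ASD.exists_of_mem_W1p0 hι hΩo hu
    rw [hI x hx]
    exact ASD.zero_le_energy_add_conjugate hd hΩo hp0 hm0 hx (hself x hx)
  obtain ⟨x, hx, hmin⟩ := ASD.exists_forall_finiteEnergy_le hn hΩb hp hm S ι (hf.toLp f) A hskew
  have hxW : ι x.1 ∈ ASD.W1p0 Ω p := ASD.inclusion_mem_W1p0 hι hΩo hx.1
  have hx0 : ASD.functional Ω p m a a₀ f (ι x.1) = 0 := by
    refine le_antisymm ?_ (hnonneg _ hxW)
    rw [hI x hx.1]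
    -- The Ky Fan point satisfies the subgradient inequality with `q = A x`, which is `I ≤ 0`.
    exact (ASD.energy_add_conjugate_nonpos_iff hd hΩo hp0 hm0 hx.1).2 ⟨hx, hmin⟩
  have hinf : sInf (ASD.functional Ω p m a a₀ f '' ASD.W1p0 Ω p) = 0 := by
    refine le_antisymm (sInf_le ⟨_, hxW, hx0⟩) (le_sInf ?_)
    rintro _ ⟨u, hu, rfl⟩
    exact hnonneg u hu
  refine ⟨fun u hu => ?_, hinf, ⟨_, hxW, hx0.trans hinf.symm⟩, fun u hu hu0 => ?_⟩
  · obtain ⟨y, hy, rfl⟩ := ASD.exists_of_mem_W1p0 hι hΩo hu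
    exact ⟨A y, hT y hy⟩
  · obtain ⟨y, hy, rfl⟩ := ASD.exists_of_mem_W1p0 hι hΩo hu
    -- Since the infimum is zero, any minimizer attains the Fenchel–Young equality and so satisfies
    -- the same variational inequality.
    rw [hinf, hI y hy] at hu0
    obtain ⟨hyD, hymin⟩ := (ASD.energy_add_conjugate_nonpos_iff hd hΩo hp0 hm0 hy).1 hu0.le
    exact ASD.isWeakSolution_of_forall_le hΩo hΩb ha ha₀ hp hm hd hA hyD (hself y hy) hymin
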